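/- An operator space is a closed linear subspace $E\subset B(H)$, $H$ a complex Hilbert space; $M_n(E)$ carries the norm of $B(\ell_2^n(H))$, and for a linear map $u\colon E\to F$ between operator spaces, $\|u\|_{cb}=\sup_{n\ge 1}\|I_{M_n}\otimes u\colon M_n(E)\to M_n(F)\|\in[0,\infty]$. Put $d_{cb}(E,F)=\inf\{\|u\|_{cb}\|u^{-1}\|_{cb}\}$, the infimum over all linear isomorphisms $u\colon E\to F$ ($=\infty$ if $E,F$ are not completely isomorphic), and $d_{SK}(E)=\inf\{d_{cb}(E,F)\}$, the infimum over all operator spaces $F$ contained in the space $K(\ell_2)$ of compact operators on $\ell_2$. For $E\subset B(H)$, $F\subset B(K)$, the minimal tensor product $E\otimes_{\min}F$ is the closure of $E\otimes F$ in $B(H\otimes_2 K)$. For a family $(F_i)_{i\in I}$ of operator spaces and an ultrafilter $\mathcal U$ on $I$, $\prod F_i/\mathcal U$ is the Banach space ultraproduct (bounded families modulo families with $\lim_{\mathcal U}\|x_i\|=0$), which is an operator space for the norms $M_n(\prod F_i/\mathcal U)=\prod M_n(F_i)/\mathcal U$. Let $E$ be a finite dimensional operator space. For every family $(F_i)_{i\in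 I}$ of operator spaces and every ultrafilter $\mathcal U$ on $I$, let $$v_E\colon \prod (E\otimes_{\min}F_i)/\mathcal U\to E\otimes_{\min}\Big(\prod F_i/\mathcal U\Big)$$ be the canonical linear isomorphism, determined by $v_E\big([(a\otimes f_i)_i]\big)=a\otimes[(f_i)_i]$ for $a\in E$ and bounded families $(f_i)$. Then $\|v_E\|\le 1$. Moreover, for every constant $C\ge 1$ the following are equivalent: (i) $d_{SK}(E)\le C$. (ii) For every set $I$, every nontrivial (i.e. nonprincipal) ultrafilter $\mathcal U$ on $I$ and every family $(F_i)_{i\in I}$ of operator spaces, $\|v_E^{-1}\|\le C$. (iii) For every countable set $I$, every nontrivial ultrafilter $\mathcal U$ on $I$ and every family $(F_i)_{i\in I}$ of operator spaces with $\sup_{i\in I}\dim F_i\le\dim E$, $\|v_E^{-1}\|\le C$. -/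

import Mathlib

open Filter Topology UniformSpace
open scoped ENNReal TensorProduct

universe u v w

noncomputable section

namespace OpSpace


/-! ### Ultraproducts of Banach spaces and of Hilbert spaces -/

section Ultraproduct

variable {I : Type*} (U : Ultrafilter I) (X : I → Type*) [∀ i, NormedAddCommGroup (X i)]
  [∀ i, NormedSpace ℂ (X i)]

/-- A shortcut for instance search. -/
instance : Module ℂ (lp X ∞) := inferInstance

/-- The bounded families `x` with `lim_U ‖x i‖ = 0`. -/
def nullFamilies : Submodule ℂ (lp X ∞) where
  carrier := {x | Tendsto (fun i => ‖x i‖) U (𝓝 0)}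
  zero_mem' := by simp
  add_mem' := by
    intro a b ha hb
    have h := Tendsto.add ha hb
    rw [add_zero] at h
    exact squeeze_zero (fun i => norm_nonneg _) (fun i => norm_add_le _ _) h
  smul_mem' := by
    intro c a ha
    have h := Tendsto.const_mul ‖c‖ ha
    rw [mul_zero] at h
    exact squeeze_zero (fun i => norm_nonneg _) (fun i => (norm_smul_le c (a i))) h

variable {U X}

theorem mem_nullFamilies {x : lp X ∞} :
    x ∈ nullFamilies U X ↔ Tendsto (fun i => ‖x i‖) U (𝓝 0) := Iff.rfl

instance isClosed_nullFamilies : IsClosed (nullFamilies U X : Set (lp X ∞)) := by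
  refine isClosed_of_closure_subset fun x hx => ?_
  change Tendsto _ _ _
  rw [Metric.tendsto_nhds]
  intro ε hε
  obtain ⟨y, hy, hxy⟩ := Metric.mem_closure_iff.1 hx (ε / 2) (half_pos hε)
  have hy' : Tendsto (fun i => ‖y i‖) U (𝓝 0) := hy
  filter_upwards [hy'.eventually (gt_mem_nhds (half_pos hε))] with i hi
  have h1 : ‖(x - y) i‖ ≤ ‖x - y‖ := lp.norm_apply_le_norm (by simp) _ i
  rw [dist_eq_norm] at hxy
  have h2 : ‖x i‖ ≤ ‖(x - y) i‖ + ‖y i‖ := by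
    simpa using norm_add_le ((x - y) i) (y i)
  rw [Real.dist_eq, sub_zero, abs_of_nonneg (norm_nonneg _)]
  linarith

variable (U X) in
/-- The ultraproduct `∏ X i / U` in the category of Banach spaces: the quotient of the space of
bounded families by the families with `U`-limit zero, with the quotient norm. -/
def Ultraproduct : Type _ := lp X ∞ ⧸ nullFamilies U X

instance : NormedAddCommGroup (Ultraproduct U X) :=
  Submodule.Quotient.normedAddCommGroup (nullFamilies U X)

instance : NormedSpace ℂ (Ultraproduct U X) :=
  Submodule.Quotient.normedSpace (nullFamilies U X) ℂ

instance [∀ i, CompleteSpace (X i)] : CompleteSpace (Ultraproduct U X) :=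
  Submodule.Quotient.completeSpace (nullFamilies U X)

variable (U) in
/-- The class of a bounded family in the ultraproduct. -/
def ultraMk : lp X ∞ →ₗ[ℂ] Ultraproduct U X := (nullFamilies U X).mkQ

/-- A linear map on bounded families that vanishes on the null families factors through the
ultraproduct. -/
def ultraLift {V : Type*} [AddCommGroup V] [Module ℂ V] (f : lp X ∞ →ₗ[ℂ] V)
    (hf : ∀ x : lp X ∞, Tendsto (fun i => ‖x i‖) U (𝓝 0) → f x = 0) : Ultraproduct U X →ₗ[ℂ] V :=
  (nullFamilies U X).liftQ f fun x hx => hf x hx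

theorem ultraLift_ultraMk {V : Type*} [AddCommGroup V] [Module ℂ V] (f : lp X ∞ →ₗ[ℂ] V)
    (hf : ∀ x : lp X ∞, Tendsto (fun i => ‖x i‖) U (𝓝 0) → f x = 0) (x : lp X ∞) :
    ultraLift f hf (ultraMk U x) = f x := rfl

theorem ultraMk_eq_zero {x : lp X ∞} :
    ultraMk U x = 0 ↔ Tendsto (fun i => ‖x i‖) U (𝓝 0) :=
  Submodule.Quotient.mk_eq_zero _

theorem ultraMk_surjective : Function.Surjective (ultraMk U : lp X ∞ → Ultraproduct U X) :=
  Submodule.mkQ_surjective _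

theorem exists_tendsto_of_bdd {f : I → ℝ} {M : ℝ} (h0 : ∀ i, 0 ≤ f i) (hM : ∀ i, f i ≤ M) :
    ∃ L, Tendsto f U (𝓝 L) := by
  obtain ⟨L, -, hL⟩ := (isCompact_Icc (a := (0 : ℝ)) (b := M)).ultrafilter_le_nhds
    (U.map f) (by
      rw [le_principal_iff]
      exact Filter.mem_map.2 (Filter.mem_of_superset univ_mem fun i _ => ⟨h0 i, hM i⟩))
  exact ⟨L, hL⟩

/-- The norm of the class of `x` is `lim_U ‖x i‖`. -/
theorem tendsto_norm_ultraMk (x : lp X ∞) :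
    Tendsto (fun i => ‖x i‖) U (𝓝 ‖ultraMk U x‖) := by
  classical
  obtain ⟨L, hL⟩ := exists_tendsto_of_bdd (U := U) (fun i => norm_nonneg (x i))
    (fun i => lp.norm_apply_le_norm (by simp) x i)
  have hL0 : 0 ≤ L := ge_of_tendsto' hL fun i => norm_nonneg _
  suffices h : ‖ultraMk U x‖ = L by rwa [h]
  apply le_antisymm
  · refine le_of_forall_pos_le_add fun ε hε => ?_
    let y : lp X ∞ := ⟨fun i => if ‖x i‖ < L + ε then x i else 0,
      memℓp_infty ⟨L + ε, by
        rintro _ ⟨i, rfl⟩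
        dsimp only
        split_ifs with h
        · exact h.le
        · simp only [norm_zero]; linarith⟩⟩
    have hy : ultraMk U x = ultraMk U y := by
      rw [← sub_eq_zero, ← map_sub, ultraMk_eq_zero]
      refine tendsto_const_nhds.congr' ?_
      filter_upwards [hL.eventually (gt_mem_nhds (show L < L + ε by linarith))] with i hi
      have : (x - y) i = x i - y i := rfl
      rw [this]
      simp [y, hi]
    rw [hy]
    refine (Submodule.Quotient.norm_mk_le (nullFamilies U X) y).trans ?_
    refine lp.norm_le_of_forall_le (by linarith) fun i => ?_
    change ‖if ‖x i‖ < L + ε then x i else 0‖ ≤ _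
    split_ifs with h
    · exact h.le
    · simp only [norm_zero]; linarith
  · refine le_of_forall_pos_le_add fun ε hε => ?_
    obtain ⟨y, h1, hlt⟩ : ∃ y : lp X ∞, ultraMk U y = ultraMk U x ∧ ‖y‖ < ‖ultraMk U x‖ + ε :=
      Submodule.Quotient.norm_mk_lt (S := nullFamilies U X) (ultraMk U x) hε
    have hxy : Tendsto (fun i => ‖(x - y) i‖) U (𝓝 0) := by
      refine ultraMk_eq_zero.1 ?_
      rw [map_sub, h1, sub_self]
    have h2 : L ≤ 0 + ‖y‖ := le_of_tendsto_of_tendsto' hL (hxy.add_const ‖y‖) fun i => by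
      have h1 : ‖x i‖ ≤ ‖(x - y) i‖ + ‖y i‖ := by
        simpa using norm_add_le ((x - y) i) (y i)
      have h3 : ‖y i‖ ≤ ‖y‖ := lp.norm_apply_le_norm (by simp) y i
      linarith
    linarith

end Ultraproduct

section Hilbert

variable {I : Type*} (U : Ultrafilter I) (H : I → Type*) [∀ i, NormedAddCommGroup (H i)]
  [∀ i, InnerProductSpace ℂ (H i)]

theorem ultraproduct_parallelogram (x y : Ultraproduct U H) :
    ‖x + y‖ * ‖x + y‖ + ‖x - y‖ * ‖x - y‖ = 2 * (‖x‖ * ‖x‖ + ‖y‖ * ‖y‖) := by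
  obtain ⟨x, rfl⟩ := ultraMk_surjective x
  obtain ⟨y, rfl⟩ := ultraMk_surjective y
  rw [← map_add, ← map_sub]
  have hp := tendsto_norm_ultraMk (U := U) (x + y)
  have hm := tendsto_norm_ultraMk (U := U) (x - y)
  have hx := tendsto_norm_ultraMk (U := U) x
  have hy := tendsto_norm_ultraMk (U := U) y
  refine tendsto_nhds_unique ((hp.mul hp).add (hm.mul hm))
    ((((hx.mul hx).add (hy.mul hy)).const_mul 2).congr fun i => ?_)
  have h := parallelogram_law_with_norm ℂ (x i) (y i)
  simp only [pow_two] at h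
  exact h.symm

/-- The ultraproduct of Hilbert spaces is a Hilbert space, with the unique inner product
that induces its norm, that is `⟪[x], [y]⟫ = lim_U ⟪x i, y i⟫`. -/
instance : InnerProductSpace ℂ (Ultraproduct U H) :=
  { InnerProductSpace.ofNorm ℂ (ultraproduct_parallelogram U H) with
    toNormedSpace := inferInstance }

variable {U H} in
theorem tendsto_inner_ultraMk (x y : lp H ∞) :
    Tendsto (fun i => inner ℂ (x i) (y i)) U (𝓝 (inner ℂ (ultraMk U x) (ultraMk U y))) := by
  have hN : ∀ z : lp H ∞, Tendsto (fun i => ((‖z i‖ : ℝ) : ℂ) ^ 2) U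
      (𝓝 (((‖ultraMk U z‖ : ℝ) : ℂ) ^ 2)) := fun z =>
    ((Complex.continuous_ofReal.tendsto _).comp (tendsto_norm_ultraMk (U := U) z)).pow 2
  have e := inner_eq_sum_norm_sq_div_four (𝕜 := ℂ) (ultraMk U x) (ultraMk U y)
  rw [e, ← map_smul, ← map_add, ← map_sub, ← map_add, ← map_sub]
  have h := ((((hN (x + y)).sub (hN (x - y))).add
    (((hN (x - (Complex.I • y))).sub (hN (x + (Complex.I • y)))).mul_const Complex.I)).div_const 4)
  refine (h.congr fun i => ?_)
  rw [inner_eq_sum_norm_sq_div_four (x i) (y i)]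
  rfl

variable {H}

/-- The bounded family `i ↦ a i (x i)`. -/
def applyFam (a : lp (fun i => H i →L[ℂ] H i) ∞) : lp H ∞ →ₗ[ℂ] lp H ∞ where
  toFun x := ⟨fun i => a i (x i), memℓp_infty ⟨‖a‖ * ‖x‖, by
    rintro _ ⟨i, rfl⟩
    exact (a i).le_of_opNorm_le_of_le (lp.norm_apply_le_norm (by simp) a i)
      (lp.norm_apply_le_norm (by simp) x i)⟩⟩
  map_add' x y := by ext i; exact map_add (a i) (x i) (y i)
  map_smul' c x := by ext i; exact map_smul (a i) c (x i)

/-- The operator on the Hilbert ultraproduct induced by a bounded family of operators,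
`[x] ↦ [a i (x i)]`. -/
def ultraOp (a : lp (fun i => H i →L[ℂ] H i) ∞) : Ultraproduct U H →L[ℂ] Ultraproduct U H :=
  LinearMap.mkContinuous
    (ultraLift (ultraMk U ∘ₗ applyFam a)
      (by
        intro x hx
        have h := Tendsto.const_mul ‖a‖ hx
        rw [mul_zero] at h
        refine ultraMk_eq_zero.2 ?_
        exact squeeze_zero (fun i => norm_nonneg _) (fun i =>
          (a i).le_of_opNorm_le (lp.norm_apply_le_norm (by simp) a i) (x i)) h))
    ‖a‖ (by
      intro x
      obtain ⟨x, rfl⟩ := ultraMk_surjective x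
      refine le_of_tendsto_of_tendsto' (tendsto_norm_ultraMk (U := U) (applyFam a x))
        ((tendsto_norm_ultraMk (U := U) x).const_mul ‖a‖) fun i => ?_
      exact (a i).le_of_opNorm_le (lp.norm_apply_le_norm (by simp) a i) (x i))

variable {U}

theorem ultraOp_ultraMk (a : lp (fun i => H i →L[ℂ] H i) ∞) (x : lp H ∞) :
    ultraOp U a (ultraMk U x) = ultraMk U (applyFam a x) := rfl

/-- The norm of the operator induced by `a` is `lim_U ‖a i‖`. -/
theorem tendsto_norm_ultraOp (a : lp (fun i => H i →L[ℂ] H i) ∞) :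
    Tendsto (fun i => ‖a i‖) U (𝓝 ‖ultraOp U a‖) := by
  obtain ⟨L, hL⟩ := exists_tendsto_of_bdd (U := U) (fun i => norm_nonneg (a i))
    (fun i => lp.norm_apply_le_norm (by simp) a i)
  have hL0 : 0 ≤ L := ge_of_tendsto' hL fun i => norm_nonneg _
  suffices h : ‖ultraOp U a‖ = L by rwa [h]
  apply le_antisymm
  · refine ContinuousLinearMap.opNorm_le_bound _ hL0 fun x => ?_
    obtain ⟨x, rfl⟩ := ultraMk_surjective x
    rw [ultraOp_ultraMk]
    exact le_of_tendsto_of_tendsto' (tendsto_norm_ultraMk (U := U) _)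
      (hL.mul (tendsto_norm_ultraMk (U := U) x)) fun i => (a i).le_opNorm (x i)
  · refine le_of_forall_pos_le_add fun ε hε => ?_
    have hex : ∀ i, ∃ x : H i, ‖x‖ ≤ 1 ∧ ‖a i‖ - ε ≤ ‖a i x‖ := by
      intro i
      by_cases h0 : ‖a i‖ - ε < 0
      · exact ⟨0, by simp, by simpa using h0.le⟩
      · obtain ⟨x, hx, hlt⟩ := (a i).exists_lt_apply_of_lt_opNorm
          (show ‖a i‖ - ε < ‖a i‖ by linarith)
        exact ⟨x, hx.le, hlt.le⟩
    choose x hx hax using hex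
    let x' : lp H ∞ := ⟨x, memℓp_infty ⟨1, by rintro _ ⟨i, rfl⟩; exact hx i⟩⟩
    have h1 : ‖ultraMk U x'‖ ≤ 1 :=
      le_of_tendsto' (tendsto_norm_ultraMk (U := U) x') fun i => hx i
    have h2 : L - ε ≤ ‖ultraOp U a (ultraMk U x')‖ := by
      rw [ultraOp_ultraMk]
      exact le_of_tendsto_of_tendsto' (hL.sub_const ε) (tendsto_norm_ultraMk (U := U) _)
        fun i => hax i
    have h3 := (ultraOp U a).le_opNorm_of_le h1
    linarith

end Hilbert

/-! ### Operator spaces -/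

/-- A (concrete) operator space: a closed linear subspace of `B(H)`, `H` a complex Hilbert
space. -/
structure OperatorSpace : Type (u + 1) where
  /-- The Hilbert space. -/
  Hilb : Type u
  [normedAddCommGroup : NormedAddCommGroup Hilb]
  [innerProductSpace : InnerProductSpace ℂ Hilb]
  [completeSpace : CompleteSpace Hilb]
  /-- The linear subspace of `B(H)`. -/
  space : Submodule ℂ (Hilb →L[ℂ] Hilb)
  isClosed : IsClosed (space : Set (Hilb →L[ℂ] Hilb))

attribute [instance] OperatorSpace.normedAddCommGroup OperatorSpace.innerProductSpace
  OperatorSpace.completeSpace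

namespace OperatorSpace

/-- The elements of an operator space, with the operator norm. -/
def Carrier (E : OperatorSpace.{u}) : Type u := E.space

instance : CoeSort OperatorSpace.{u} (Type u) := ⟨Carrier⟩

variable (E : OperatorSpace.{u})

instance : NormedAddCommGroup E := inferInstanceAs (NormedAddCommGroup E.space)

instance : NormedSpace ℂ E := inferInstanceAs (NormedSpace ℂ E.space)

instance : CompleteSpace E := E.isClosed.completeSpace_coe

/-- The inclusion of an operator space in `B(H)`. -/
def val : E →ₗᵢ[ℂ] (E.Hilb →L[ℂ] E.Hilb) := E.space.subtypeₗᵢ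

variable {E}

/-- An operator that belongs to the subspace, as an element of the operator space. -/
def ofMem {T : E.Hilb →L[ℂ] E.Hilb} (hT : T ∈ E.space) : E := ⟨T, hT⟩

theorem val_ofMem {T : E.Hilb →L[ℂ] E.Hilb} (hT : T ∈ E.space) : E.val (ofMem hT) = T := rfl

theorem val_mem (a : E) : E.val a ∈ E.space := Subtype.property (p := fun T => T ∈ E.space) a

theorem val_injective : Function.Injective E.val := E.val.injective

end OperatorSpace

open OperatorSpace

section Ultra

variable {I : Type w} (U : Ultrafilter I) (F : I → OperatorSpace.{v})

/-- A bounded family of elements of `F i`, seen as a bounded family of operators. -/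
def valFam : lp (fun i => F i) ∞ →ₗ[ℂ] lp (fun i => (F i).Hilb →L[ℂ] (F i).Hilb) ∞ where
  toFun f := ⟨fun i => (F i).val (f i), memℓp_infty ⟨‖f‖, by
    rintro _ ⟨i, rfl⟩
    exact lp.norm_apply_le_norm (by simp) f i⟩⟩
  map_add' _ _ := rfl
  map_smul' _ _ := rfl

/-- `f ↦ ultraOp U f`, as a linear map on bounded families. -/
def ultraRep : lp (fun i => F i) ∞ →ₗ[ℂ]
    (Ultraproduct U (fun i => (F i).Hilb) →L[ℂ] Ultraproduct U (fun i => (F i).Hilb)) where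
  toFun f := ultraOp U (valFam F f)
  map_add' f g := by
    ext x
    obtain ⟨x, rfl⟩ := ultraMk_surjective x
    rfl
  map_smul' c f := by
    ext x
    obtain ⟨x, rfl⟩ := ultraMk_surjective x
    rfl

theorem norm_ultraRep (f : lp (fun i => F i) ∞) : ‖ultraRep U F f‖ = ‖ultraMk U f‖ :=
  tendsto_nhds_unique (tendsto_norm_ultraOp (U := U) (valFam F f)) (tendsto_norm_ultraMk f)

/-- The representation `[f] ↦ ([x] ↦ [f i (x i)])` of the Banach space ultraproduct `∏ F i / U`
on the Hilbert space `∏ H i / U`, where `F i ⊆ B(H i)`. It is isometric. -/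
def ultraEmb : Ultraproduct U (fun i => F i) →ₗᵢ[ℂ]
    (Ultraproduct U (fun i => (F i).Hilb) →L[ℂ] Ultraproduct U (fun i => (F i).Hilb)) where
  toLinearMap := ultraLift (ultraRep U F) (by
    intro f hf
    have h : ultraMk U f = 0 := ultraMk_eq_zero.2 hf
    exact norm_eq_zero.1 (by rw [norm_ultraRep, h, norm_zero]))
  norm_map' f := by
    obtain ⟨f, rfl⟩ := ultraMk_surjective f
    exact norm_ultraRep U F f

/-- The operator space ultraproduct `∏ F i / U` of a family of operator spaces `F i ⊆ B(H i)`: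
the Banach space ultraproduct, realized on the ultraproduct of the Hilbert spaces `H i`. -/
def opUltraproduct : OperatorSpace where
  Hilb := Ultraproduct U (fun i => (F i).Hilb)
  space := LinearMap.range (ultraEmb U F).toLinearMap
  isClosed := (ultraEmb U F).isometry.isClosedEmbedding.isClosed_range

/-- The class of the bounded family `f`, as an element of the operator space ultraproduct. -/
def opMk : lp (fun i => F i) ∞ →ₗ[ℂ] opUltraproduct U F :=
  (ultraEmb U F).toLinearMap.rangeRestrict ∘ₗ ultraMk U

variable {F}

theorem val_opMk (f : lp (fun i => F i) ∞) :
    (opUltraproduct U F).val (opMk U F f) = ultraOp U (valFam F f) := rfl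

theorem opMk_eq_zero {f : lp (fun i => F i) ∞} :
    opMk U F f = 0 ↔ Tendsto (fun i => ‖f i‖) U (𝓝 0) := by
  rw [← ultraMk_eq_zero]
  refine Iff.trans ?_ ((ultraEmb U F).toLinearMap.map_eq_zero_iff (ultraEmb U F).injective)
  exact (Subtype.coe_inj (a := opMk U F f) (b := 0)).symm

theorem opMk_surjective : Function.Surjective (opMk U F) :=
  (LinearMap.surjective_rangeRestrict _).comp ultraMk_surjective

end Ultra

/-! ### The minimal tensor product -/

section Min

variable {H K : Type*} [NormedAddCommGroup H] [InnerProductSpace ℂ H]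
  [NormedAddCommGroup K] [InnerProductSpace ℂ K]

variable (H K) in
/-- The Hilbert space tensor product `H ⊗₂ K`. -/
def HilbertTensor : Type _ := Completion (H ⊗[ℂ] K)

instance : NormedAddCommGroup (HilbertTensor H K) :=
  inferInstanceAs (NormedAddCommGroup (Completion (H ⊗[ℂ] K)))

instance : InnerProductSpace ℂ (HilbertTensor H K) :=
  inferInstanceAs (InnerProductSpace ℂ (Completion (H ⊗[ℂ] K)))

instance : CompleteSpace (HilbertTensor H K) :=
  inferInstanceAs (CompleteSpace (Completion (H ⊗[ℂ] K)))

/-- The inclusion of the linear tensor product. -/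
def toHilbertTensor : H ⊗[ℂ] K →ₗᵢ[ℂ] HilbertTensor H K :=
  (Completion.toComplₗᵢ : H ⊗[ℂ] K →ₗᵢ[ℂ] Completion (H ⊗[ℂ] K))

theorem denseRange_toHilbertTensor :
    DenseRange (toHilbertTensor : H ⊗[ℂ] K → HilbertTensor H K) :=
  Completion.denseRange_coe

theorem hilbertTensor_ext {S T : HilbertTensor H K →L[ℂ] HilbertTensor H K}
    (hST : ∀ (h : H) (k : K), S (toHilbertTensor (h ⊗ₜ k)) = T (toHilbertTensor (h ⊗ₜ k))) :
    S = T := by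
  ext x
  refine denseRange_toHilbertTensor.induction_on (p := fun x => S x = T x) x
    (isClosed_eq S.continuous T.continuous) fun x => ?_
  induction x using TensorProduct.induction_on with
  | zero => rw [map_zero, map_zero, map_zero]
  | tmul h k => exact hST h k
  | add x y hx hy => rw [map_add, map_add, map_add, hx, hy]

/-- The operator `a ⊗ b` on `H ⊗₂ K`. -/
def opTmul (a : H →L[ℂ] H) (b : K →L[ℂ] K) : HilbertTensor H K →L[ℂ] HilbertTensor H K :=
  (TensorProduct.mapL a b).completion

theorem opTmul_apply (a : H →L[ℂ] H) (b : K →L[ℂ] K) (x : H ⊗[ℂ] K) :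
    opTmul a b (toHilbertTensor x) = toHilbertTensor (TensorProduct.mapL a b x) :=
  ContinuousLinearMap.completion_apply_coe _ _

theorem opTmul_tmul (a : H →L[ℂ] H) (b : K →L[ℂ] K) (h : H) (k : K) :
    opTmul a b (toHilbertTensor (h ⊗ₜ k)) = toHilbertTensor (a h ⊗ₜ b k) := by
  rw [opTmul_apply, TensorProduct.mapL_tmul]

/-- The operator `a ⊗ b` on `H ⊗₂ K`, as a bilinear map of `(a, b)`. -/
def opTensor : (H →L[ℂ] H) →ₗ[ℂ] (K →L[ℂ] K) →ₗ[ℂ] (HilbertTensor H K →L[ℂ] HilbertTensor H K) :=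
  LinearMap.mk₂ ℂ opTmul
    (fun a a' b => hilbertTensor_ext fun h k => by
      simp [opTmul_tmul, TensorProduct.add_tmul])
    (fun c a b => hilbertTensor_ext fun h k => by
      simp [opTmul_tmul, ← TensorProduct.smul_tmul'])
    (fun a b b' => hilbertTensor_ext fun h k => by
      simp [opTmul_tmul, TensorProduct.tmul_add])
    (fun c a b => hilbertTensor_ext fun h k => by
      simp [opTmul_tmul])

theorem opTensor_tmul (a : H →L[ℂ] H) (b : K →L[ℂ] K) (h : H) (k : K) :
    opTensor a b (toHilbertTensor (h ⊗ₜ k)) = toHilbertTensor (a h ⊗ₜ b k) :=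
  opTmul_tmul a b h k

theorem norm_opTensor_le (a : H →L[ℂ] H) (b : K →L[ℂ] K) : ‖opTensor a b‖ ≤ ‖a‖ * ‖b‖ := by
  refine ContinuousLinearMap.opNorm_le_bound _ (by positivity) fun x => ?_
  refine denseRange_toHilbertTensor.induction_on
    (p := fun x => ‖opTensor a b x‖ ≤ ‖a‖ * ‖b‖ * ‖x‖) x
    (isClosed_le (opTensor a b).continuous.norm (continuous_const.mul continuous_norm)) fun x => ?_
  change ‖opTmul a b (toHilbertTensor x)‖ ≤ _
  rw [opTmul_apply, LinearIsometry.norm_map, LinearIsometry.norm_map]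
  exact ContinuousLinearMap.le_of_opNorm_le _ (TensorProduct.norm_mapL_le a b) x

/-- `k ↦ h ⊗ k`. -/
def tmulLeft (h : H) : K →L[ℂ] HilbertTensor H K :=
  toHilbertTensor.toContinuousLinearMap ∘L TensorProduct.mkL ℂ H K h

/-- The slice map `a ⊗ b ↦ ⟪ξ, a η⟫ b`. -/
def slice [CompleteSpace K] (ξ η : H) :
    (HilbertTensor H K →L[ℂ] HilbertTensor H K) →ₗ[ℂ] (K →L[ℂ] K) where
  toFun T := (ContinuousLinearMap.adjoint (tmulLeft (K := K) ξ)) ∘L T ∘L tmulLeft η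
  map_add' S T := by ext; simp
  map_smul' c T := by ext; simp

theorem norm_tmulLeft_le (h : H) : ‖tmulLeft (K := K) h‖ ≤ ‖h‖ :=
  ContinuousLinearMap.opNorm_le_bound _ (norm_nonneg _) fun k => by
    change ‖toHilbertTensor (h ⊗ₜ[ℂ] k)‖ ≤ _
    rw [LinearIsometry.norm_map, TensorProduct.norm_tmul]

theorem norm_slice_le [CompleteSpace K] (ξ η : H)
    (T : HilbertTensor H K →L[ℂ] HilbertTensor H K) : ‖slice ξ η T‖ ≤ ‖ξ‖ * ‖η‖ * ‖T‖ := by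
  have h1 := norm_tmulLeft_le (K := K) ξ
  have h2 := norm_tmulLeft_le (K := K) η
  have h3 : ‖ContinuousLinearMap.adjoint (tmulLeft (K := K) ξ)‖ ≤ ‖ξ‖ := by
    rwa [LinearIsometryEquiv.norm_map]
  calc ‖slice ξ η T‖ ≤ ‖ContinuousLinearMap.adjoint (tmulLeft (K := K) ξ)‖ *
        (‖T‖ * ‖tmulLeft (K := K) η‖) :=
        (ContinuousLinearMap.opNorm_comp_le _ _).trans
          (mul_le_mul_of_nonneg_left (ContinuousLinearMap.opNorm_comp_le _ _) (norm_nonneg _))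
    _ ≤ ‖ξ‖ * (‖T‖ * ‖η‖) := by gcongr
    _ = ‖ξ‖ * ‖η‖ * ‖T‖ := by ring

theorem slice_opTensor [CompleteSpace K] (ξ η : H) (a : H →L[ℂ] H) (b : K →L[ℂ] K) :
    slice ξ η (opTensor a b) = inner ℂ ξ (a η) • b := by
  ext k
  refine ext_inner_left ℂ fun k' => ?_
  change inner ℂ k' (ContinuousLinearMap.adjoint (tmulLeft ξ) (opTensor a b (tmulLeft η k))) = _
  rw [ContinuousLinearMap.adjoint_inner_right]
  change inner ℂ (toHilbertTensor (ξ ⊗ₜ[ℂ] k')) (opTensor a b (toHilbertTensor (η ⊗ₜ[ℂ] k))) = _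
  rw [opTensor_tmul, LinearIsometry.inner_map_map, TensorProduct.inner_tmul]
  simp [inner_smul_right]

end Min

section MinTensor

/-- The minimal (spatial) tensor product of `E ⊆ B(H)` and `F ⊆ B(K)`: the closure of the linear
tensor product of `E` and `F` in `B(H ⊗₂ K)`. -/
def minTensor (E : OperatorSpace.{u}) (F : OperatorSpace.{v}) : OperatorSpace where
  Hilb := HilbertTensor E.Hilb F.Hilb
  space := (Submodule.span ℂ {T | ∃ (a : E) (b : F),
    T = opTensor (E.val a) (F.val b)}).topologicalClosure
  isClosed := Submodule.isClosed_topologicalClosure _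

variable (E : OperatorSpace.{u}) (F : OperatorSpace.{v})

theorem opTensor_mem (a : E) (b : F) :
    opTensor (E.val a) (F.val b) ∈ (minTensor E F).space :=
  Submodule.le_topologicalClosure _ (Submodule.subset_span ⟨a, b, rfl⟩)

/-- The elementary tensor `a ⊗ b` as an element of `E ⊗_min F`, as a bilinear map. -/
def minTmul : E →ₗ[ℂ] F →ₗ[ℂ] minTensor E F :=
  LinearMap.mk₂ ℂ (fun a b => ofMem (opTensor_mem E F a b))
    (fun a a' b => val_injective (by
      change opTensor (E.val (a + a')) (F.val b) =
        opTensor (E.val a) (F.val b) + opTensor (E.val a') (F.val b)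
      simp))
    (fun c a b => val_injective (by
      change opTensor (E.val (c • a)) (F.val b) =
        c • opTensor (E.val a) (F.val b)
      simp))
    (fun a b b' => val_injective (by
      change opTensor (E.val a) (F.val (b + b')) =
        opTensor (E.val a) (F.val b) + opTensor (E.val a) (F.val b')
      simp))
    (fun c a b => val_injective (by
      change opTensor (E.val a) (F.val (c • b)) =
        c • opTensor (E.val a) (F.val b)
      simp))

/-- The inclusion of `E ⊗_min F` in `B(H ⊗₂ K)`. -/
def minVal : minTensor E F →ₗᵢ[ℂ]
    (HilbertTensor E.Hilb F.Hilb →L[ℂ] HilbertTensor E.Hilb F.Hilb) := (minTensor E F).val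

theorem minVal_minTmul (a : E) (b : F) :
    minVal E F (minTmul E F a b) = opTensor (E.val a) (F.val b) := rfl

theorem norm_minTmul_le (a : E) (b : F) : ‖minTmul E F a b‖ ≤ ‖a‖ * ‖b‖ :=
  norm_opTensor_le (E.val a) (F.val b)

end MinTensor

theorem minVal_induction {E : OperatorSpace.{u}} {F : OperatorSpace.{v}}
    {P : (HilbertTensor E.Hilb F.Hilb →L[ℂ] HilbertTensor E.Hilb F.Hilb) → Prop}
    (hc : IsClosed {T | P T}) (h0 : P 0) (ht : ∀ (a : E) (b : F), P (opTensor (E.val a) (F.val b)))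
    (hadd : ∀ S T, P S → P T → P (S + T)) (hsmul : ∀ (c : ℂ) T, P T → P (c • T))
    (t : minTensor E F) : P (minVal E F t) := by
  have h : (minVal E F t) ∈ closure ((Submodule.span ℂ {T | ∃ (a : E) (b : F),
    T = opTensor (E.val a) (F.val b)} :
      Submodule ℂ (HilbertTensor E.Hilb F.Hilb →L[ℂ] HilbertTensor E.Hilb F.Hilb)) :
        Set (HilbertTensor E.Hilb F.Hilb →L[ℂ] HilbertTensor E.Hilb F.Hilb)) := val_mem t
  refine closure_minimal (t := {T | P T}) ?_ hc h
  intro S hS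
  refine Submodule.span_induction (p := fun S _ => P S) ?_ h0 (fun S T _ _ => hadd S T)
    (fun c T _ => hsmul c T) hS
  rintro _ ⟨a, b, rfl⟩
  exact ht a b


/-! ### Slicing along a basis of a finite dimensional operator space -/

section Coordinates

variable (E : OperatorSpace.{u}) [FiniteDimensional ℂ E]

/-- A basis of `E`. -/
def basisOf : Module.Basis (Fin (Module.finrank ℂ E)) ℂ E := Module.finBasis ℂ E

/-- The functional `a ↦ ⟪ξ, a η⟫` on `E`, for `p = (ξ, η)`. -/
def vectorFunctional (E : OperatorSpace.{u}) (p : E.Hilb × E.Hilb) : Module.Dual ℂ E where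
  toFun a := inner ℂ p.1 (E.val a p.2)
  map_add' a b := by simp
  map_smul' c a := by simp

theorem exists_coord_eq (k : Fin (Module.finrank ℂ E)) :
    ∃ c : (E.Hilb × E.Hilb) →₀ ℂ,
      (c.sum fun p z => z • vectorFunctional E p) = (basisOf E).coord k := by
  rw [← Finsupp.mem_span_range_iff_exists_finsupp]
  have h0 : (Submodule.span ℂ (Set.range (vectorFunctional E))).dualCoannihilator = ⊥ := by
    rw [eq_bot_iff]
    intro a ha
    rw [Submodule.mem_dualCoannihilator] at ha
    rw [Submodule.mem_bot]
    refine val_injective ?_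
    rw [map_zero]
    ext η
    refine ext_inner_left ℂ fun ξ => ?_
    have h : inner ℂ ξ (E.val a η) = 0 :=
      ha (vectorFunctional E (ξ, η)) (Submodule.subset_span ⟨_, rfl⟩)
    rw [h]
    simp
  have h1 : Submodule.span ℂ (Set.range (vectorFunctional E)) = ⊤ := by
    rw [← Subspace.dualCoannihilator_dualAnnihilator_eq
      (W := Submodule.span ℂ (Set.range (vectorFunctional E))), h0, Submodule.dualAnnihilator_bot]
  rw [h1]
  trivial

/-- Coefficients expressing the `k`-th coordinate on `E` through the functionals
`a ↦ ⟪ξ, a η⟫`. -/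
def coordCoeff (k : Fin (Module.finrank ℂ E)) : (E.Hilb × E.Hilb) →₀ ℂ :=
  (exists_coord_eq E k).choose

theorem sum_coordCoeff (k : Fin (Module.finrank ℂ E)) (a : E) :
    ∑ p ∈ (coordCoeff E k).support, coordCoeff E k p * inner ℂ p.1 (E.val a p.2) =
      (basisOf E).coord k a := by
  rw [← (exists_coord_eq E k).choose_spec, Finsupp.sum, LinearMap.sum_apply]
  rfl

/-- A bound for the norm of the slice map of the `k`-th coordinate. -/
def coordBound (k : Fin (Module.finrank ℂ E)) : ℝ :=
  ∑ p ∈ (coordCoeff E k).support, ‖coordCoeff E k p‖ * (‖p.1‖ * ‖p.2‖)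

theorem coordBound_nonneg (k : Fin (Module.finrank ℂ E)) : 0 ≤ coordBound E k :=
  Finset.sum_nonneg fun p _ => by positivity

variable (K : Type*) [NormedAddCommGroup K] [InnerProductSpace ℂ K] [CompleteSpace K]

/-- The slice map that sends `a ⊗ b` with `a ∈ E` to `a_k b`, where `a_k` is the `k`-th coordinate
of `a`. -/
def coordSlice (k : Fin (Module.finrank ℂ E)) :
    (HilbertTensor E.Hilb K →L[ℂ] HilbertTensor E.Hilb K) →ₗ[ℂ] (K →L[ℂ] K) :=
  ∑ p ∈ (coordCoeff E k).support, coordCoeff E k p • slice p.1 p.2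

variable {K}

theorem coordSlice_apply (k : Fin (Module.finrank ℂ E))
    (T : HilbertTensor E.Hilb K →L[ℂ] HilbertTensor E.Hilb K) :
    coordSlice E K k T =
      ∑ p ∈ (coordCoeff E k).support, coordCoeff E k p • slice p.1 p.2 T := by
  rw [coordSlice, LinearMap.sum_apply]
  rfl

theorem norm_coordSlice_le (k : Fin (Module.finrank ℂ E))
    (T : HilbertTensor E.Hilb K →L[ℂ] HilbertTensor E.Hilb K) :
    ‖coordSlice E K k T‖ ≤ coordBound E k * ‖T‖ := by
  rw [coordSlice_apply, coordBound, Finset.sum_mul]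
  refine norm_sum_le_of_le _ fun p _ => ?_
  rw [mul_assoc]
  exact (norm_smul_le _ _).trans
    (mul_le_mul_of_nonneg_left (norm_slice_le _ _ _) (norm_nonneg _))

theorem continuous_coordSlice (k : Fin (Module.finrank ℂ E)) : Continuous (coordSlice E K k) :=
  AddMonoidHomClass.continuous_of_bound _ _ fun T => norm_coordSlice_le E k T

theorem coordSlice_opTensor (k : Fin (Module.finrank ℂ E)) (a : E) (b : K →L[ℂ] K) :
    coordSlice E K k (opTensor (E.val a) b) = (basisOf E).coord k a • b := by
  rw [coordSlice_apply, ← sum_coordCoeff, Finset.sum_smul]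
  refine Finset.sum_congr rfl fun p _ => ?_
  rw [slice_opTensor, smul_smul]

variable {E} {F : OperatorSpace.{v}}

theorem coordSlice_mem (k : Fin (Module.finrank ℂ E)) (t : minTensor E F) :
    coordSlice E F.Hilb k (minVal E F t) ∈ F.space := by
  refine minVal_induction (P := fun T => coordSlice E F.Hilb k T ∈ F.space)
    (F.isClosed.preimage (continuous_coordSlice E k)) ?_ ?_ ?_ ?_ t
  · rw [map_zero]; exact F.space.zero_mem
  · intro a b
    rw [coordSlice_opTensor]
    exact F.space.smul_mem _ (val_mem b)
  · intro S T hS hT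
    rw [map_add]; exact F.space.add_mem hS hT
  · intro c T hT
    rw [map_smul]; exact F.space.smul_mem c hT

theorem sum_coordSlice (t : minTensor E F) :
    ∑ k, opTensor (E.val (basisOf E k)) (coordSlice E F.Hilb k (minVal E F t)) =
      minVal E F t := by
  refine minVal_induction
    (P := fun T => ∑ k, opTensor (E.val (basisOf E k)) (coordSlice E F.Hilb k T) = T)
    (isClosed_eq ?_ continuous_id) ?_ ?_ ?_ ?_ t
  · refine continuous_finsetSum _ fun k _ => ?_
    have h : Continuous (opTensor (K := F.Hilb) (E.val (basisOf E k))) :=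
      AddMonoidHomClass.continuous_of_bound _ _ fun b => norm_opTensor_le _ b
    exact h.comp (continuous_coordSlice E k)
  · simp
  · intro a b
    have h : ∀ k, opTensor (E.val (basisOf E k))
        (coordSlice E F.Hilb k (opTensor (E.val a) (F.val b))) =
        opTensor (E.val ((basisOf E).repr a k • basisOf E k)) (F.val b) := by
      intro k
      rw [coordSlice_opTensor, map_smul, map_smul, map_smul, LinearMap.smul_apply]
      rfl
    rw [Finset.sum_congr rfl fun k _ => h k, ← LinearMap.sum_apply, ← map_sum, ← map_sum,
      (basisOf E).sum_repr]
  · intro S T hS hT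
    simp only [map_add, Finset.sum_add_distrib]
    rw [hS, hT]
  · intro c T hT
    simp only [map_smul, ← Finset.smul_sum]
    rw [hT]

theorem coordSlice_sum (b : Fin (Module.finrank ℂ E) → (K →L[ℂ] K))
    (k : Fin (Module.finrank ℂ E)) :
    coordSlice E K k (∑ j, opTensor (E.val (basisOf E j)) (b j)) = b k := by
  classical
  rw [map_sum, Finset.sum_eq_single k]
  · rw [coordSlice_opTensor, Module.Basis.coord_apply, Module.Basis.repr_self,
      Finsupp.single_eq_same, one_smul]
  · intro j _ hj
    rw [coordSlice_opTensor, Module.Basis.coord_apply, Module.Basis.repr_self,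
      Finsupp.single_eq_of_ne hj.symm, zero_smul]
  · simp

end Coordinates

/-! ### The canonical map -/

section Canonical

variable {I : Type w} (U : Ultrafilter I) (E : OperatorSpace.{u}) (F : I → OperatorSpace.{v})

/-- For `a ∈ E` and a bounded family `f`, the bounded family `i ↦ a ⊗ f i`. -/
def tmulFam : E →ₗ[ℂ] lp (fun i => F i) ∞ →ₗ[ℂ] lp (fun i => minTensor E (F i)) ∞ :=
  LinearMap.mk₂ ℂ (fun a f => ⟨fun i => minTmul E (F i) a (f i), memℓp_infty ⟨‖a‖ * ‖f‖, by
      rintro _ ⟨i, rfl⟩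
      exact (norm_minTmul_le E (F i) a (f i)).trans (mul_le_mul_of_nonneg_left
        (lp.norm_apply_le_norm (by simp) f i) (norm_nonneg a))⟩⟩)
    (fun a a' f => lp.ext (funext fun i => LinearMap.map_add₂ (minTmul E (F i)) a a' (f i)))
    (fun c a f => lp.ext (funext fun i => LinearMap.map_smul₂ (minTmul E (F i)) c a (f i)))
    (fun a f f' => lp.ext (funext fun i => map_add (minTmul E (F i) a) (f i) (f' i)))
    (fun c a f => lp.ext (funext fun i => map_smul (minTmul E (F i) a) c (f i)))

/-- The natural map `E ⊗ ℓ_∞{F i} → ℓ_∞{E ⊗_min F i}`, `a ⊗ f ↦ (a ⊗ f i)_i`. -/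
def toFam : E ⊗[ℂ] lp (fun i => F i) ∞ →ₗ[ℂ] lp (fun i => minTensor E (F i)) ∞ :=
  TensorProduct.lift (tmulFam E F)

/-- The natural map `E ⊗ ℓ_∞{F i} → E ⊗_min (∏ F i / U)`, `a ⊗ f ↦ a ⊗ [f]`. -/
def toMin : E ⊗[ℂ] lp (fun i => F i) ∞ →ₗ[ℂ] minTensor E (opUltraproduct U F) :=
  TensorProduct.lift ((minTmul E (opUltraproduct U F)).compl₂ (opMk U F))

variable {E F} [FiniteDimensional ℂ E]

theorem exists_sum_tmul {M : Type*} [AddCommGroup M] [Module ℂ M] (x : E ⊗[ℂ] M) :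
    ∃ m : Fin (Module.finrank ℂ E) → M, x = ∑ k, basisOf E k ⊗ₜ[ℂ] m k := by
  obtain ⟨c, rfl⟩ := TensorProduct.eq_repr_basis_left (basisOf E) x
  exact ⟨c, Finsupp.sum_fintype _ _ fun k => TensorProduct.tmul_zero _ _⟩

theorem toFam_sum (f : Fin (Module.finrank ℂ E) → lp (fun i => F i) ∞) (i : I) :
    minVal E (F i) (toFam E F (∑ k, basisOf E k ⊗ₜ[ℂ] f k) i) =
      ∑ k, opTensor (E.val (basisOf E k)) ((F i).val (f k i)) := by
  rw [map_sum, lp.coeFn_sum, Finset.sum_apply, map_sum]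
  rfl

theorem toMin_sum (f : Fin (Module.finrank ℂ E) → lp (fun i => F i) ∞) :
    minVal E (opUltraproduct U F) (toMin U E F (∑ k, basisOf E k ⊗ₜ[ℂ] f k)) =
      ∑ k, opTensor (E.val (basisOf E k)) ((opUltraproduct U F).val (opMk U F (f k))) := by
  rw [map_sum, map_sum]
  rfl

theorem toFam_injective : Function.Injective (toFam E F) := by
  refine (injective_iff_map_eq_zero _).2 fun x hx => ?_
  obtain ⟨f, rfl⟩ := exists_sum_tmul x
  have h : ∀ k, f k = 0 := by
    intro k
    refine lp.ext (funext fun i => val_injective ?_)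
    rw [← coordSlice_sum (fun j => (F i).val (f j i)) k, ← toFam_sum, hx]
    exact ((congrArg (coordSlice E (F i).Hilb k) (map_zero (minVal E (F i)))).trans
      (map_zero _)).trans (map_zero (F i).val).symm
  simp [h]

theorem toFam_surjective : Function.Surjective (toFam E F) := by
  intro t
  let f : Fin (Module.finrank ℂ E) → lp (fun i => F i) ∞ := fun k =>
    ⟨fun i => ofMem (coordSlice_mem k (t i)), memℓp_infty ⟨coordBound E k * ‖t‖, by
      rintro _ ⟨i, rfl⟩
      exact (norm_coordSlice_le E k (minVal E (F i) (t i))).trans (mul_le_mul_of_nonneg_left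
        (lp.norm_apply_le_norm (by simp) t i) (coordBound_nonneg E k))⟩⟩
  refine ⟨∑ k, basisOf E k ⊗ₜ[ℂ] f k, lp.ext (funext fun i => (minVal E (F i)).injective ?_)⟩
  rw [toFam_sum]
  exact sum_coordSlice (t i)

/-- For finite dimensional `E`, the identification `E ⊗ ℓ_∞{F i} = ℓ_∞{E ⊗_min F i}`. -/
def famEquiv : E ⊗[ℂ] lp (fun i => F i) ∞ ≃ₗ[ℂ] lp (fun i => minTensor E (F i)) ∞ :=
  LinearEquiv.ofBijective (toFam E F) ⟨toFam_injective, toFam_surjective⟩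

theorem toMin_eq_zero_iff (x : E ⊗[ℂ] lp (fun i => F i) ∞) :
    toMin U E F x = 0 ↔ Tendsto (fun i => ‖toFam E F x i‖) U (𝓝 0) := by
  obtain ⟨f, rfl⟩ := exists_sum_tmul x
  have h1 : toMin U E F (∑ k, basisOf E k ⊗ₜ[ℂ] f k) = 0 ↔ ∀ k, opMk U F (f k) = 0 := by
    constructor
    · intro h k
      refine val_injective ?_
      rw [← coordSlice_sum (fun j => (opUltraproduct U F).val (opMk U F (f j))) k]
      have h2 := toMin_sum U f
      rw [h, map_zero] at h2
      exact ((congrArg (coordSlice E (opUltraproduct U F).Hilb k) h2.symm).trans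
        (map_zero _)).trans (map_zero (opUltraproduct U F).val).symm
    · intro h
      refine (minVal E (opUltraproduct U F)).injective ?_
      rw [toMin_sum, map_zero]
      exact Finset.sum_eq_zero fun k _ => by rw [h k, map_zero, map_zero]
  rw [h1]
  simp only [opMk_eq_zero]
  constructor
  · intro h
    have h2 : Tendsto (fun i => ∑ k, ‖basisOf E k‖ * ‖f k i‖) U (𝓝 0) := by
      have h3 := tendsto_finsetSum (Finset.univ : Finset (Fin (Module.finrank ℂ E)))
        fun k _ => (h k).const_mul ‖basisOf E k‖
      simpa using h3
    refine squeeze_zero (fun i => norm_nonneg _) (fun i => ?_) h2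
    rw [← (minVal E (F i)).norm_map, toFam_sum]
    exact norm_sum_le_of_le _ fun k _ => norm_opTensor_le _ _
  · intro h k
    have h2 := h.const_mul (coordBound E k)
    rw [mul_zero] at h2
    refine squeeze_zero (fun i => norm_nonneg _) (fun i => ?_) h2
    rw [← (F i).val.norm_map, ← (minVal E (F i)).norm_map,
      ← coordSlice_sum (fun j => (F i).val (f j i)) k, ← toFam_sum]
    exact norm_coordSlice_le E k _

theorem toMin_surjective : Function.Surjective (toMin U E F) := by
  intro t
  choose f hf using fun k => opMk_surjective U (F := F) (ofMem (coordSlice_mem k t))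
  refine ⟨∑ k, basisOf E k ⊗ₜ[ℂ] f k, (minVal E (opUltraproduct U F)).injective ?_⟩
  rw [toMin_sum]
  simp only [hf]
  exact sum_coordSlice t

variable (E F)

/-- The canonical map `v_E : ∏ (E ⊗_min F i) / U → E ⊗_min (∏ F i / U)`, for finite
dimensional `E`: it is obtained from `E ⊗ ℓ_∞{F i} → E ⊗_min (∏ F i / U)` and the identification
`E ⊗ ℓ_∞{F i} = ℓ_∞{E ⊗_min F i}`, by passing to the quotient by the families with `U`-limit
zero. -/
def canonicalMap :
    Ultraproduct U (fun i => minTensor E (F i)) →ₗ[ℂ] minTensor E (opUltraproduct U F) :=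
  ultraLift (toMin U E F ∘ₗ (famEquiv (E := E) (F := F)).symm.toLinearMap) (by
    intro t ht
    refine (toMin_eq_zero_iff U _).2 ?_
    have h : toFam E F (famEquiv.symm t) = t := famEquiv.apply_symm_apply t
    change Tendsto (fun i => ‖toFam E F (famEquiv.symm t) i‖) U (𝓝 0)
    rw [h]
    exact ht)

theorem canonicalMap_famEquiv (x : E ⊗[ℂ] lp (fun i => F i) ∞) :
    canonicalMap U E F (ultraMk U (famEquiv x)) = toMin U E F x :=
  congrArg (toMin U E F) (famEquiv.symm_apply_apply x)

/-- `v_E [(a ⊗ f i)_i] = a ⊗ [f]`. -/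
theorem canonicalMap_tmulFam (a : E) (f : lp (fun i => F i) ∞) :
    canonicalMap U E F (ultraMk U (tmulFam E F a f)) =
      minTmul E (opUltraproduct U F) a (opMk U F f) :=
  canonicalMap_famEquiv U E F (a ⊗ₜ[ℂ] f)

theorem canonicalMap_bijective : Function.Bijective (canonicalMap U E F) := by
  constructor
  · refine (injective_iff_map_eq_zero _).2 fun t ht => ?_
    obtain ⟨t, rfl⟩ := ultraMk_surjective t
    obtain ⟨x, rfl⟩ := famEquiv.surjective t
    rw [canonicalMap_famEquiv, toMin_eq_zero_iff] at ht
    exact ultraMk_eq_zero.2 ht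
  · intro t
    obtain ⟨x, rfl⟩ := toMin_surjective U t
    exact ⟨ultraMk U (famEquiv x), canonicalMap_famEquiv U E F x⟩

/-- The canonical isomorphism `v_E : ∏ (E ⊗_min F i) / U ≃ E ⊗_min (∏ F i / U)`. -/
def canonicalEquiv :
    Ultraproduct U (fun i => minTensor E (F i)) ≃ₗ[ℂ] minTensor E (opUltraproduct U F) :=
  LinearEquiv.ofBijective (canonicalMap U E F) (canonicalMap_bijective U E F)

end Canonical

/-! ### Complete boundedness and the distance to subspaces of the compact operators -/

section CB

/-- The operator on `ℓ₂ⁿ(H)` with matrix `A`. -/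
def matrixOp {H : Type*} [NormedAddCommGroup H] [InnerProductSpace ℂ H] {n : ℕ}
    (A : Matrix (Fin n) (Fin n) (H →L[ℂ] H)) :
    PiLp 2 (fun _ : Fin n => H) →L[ℂ] PiLp 2 (fun _ : Fin n => H) :=
  (PiLp.continuousLinearEquiv 2 ℂ (fun _ : Fin n => H)).symm.toContinuousLinearMap ∘L
    ContinuousLinearMap.pi fun i => ∑ j, A i j ∘L PiLp.proj 2 (fun _ : Fin n => H) j

theorem matrixOp_apply {H : Type*} [NormedAddCommGroup H] [InnerProductSpace ℂ H] {n : ℕ}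
    (A : Matrix (Fin n) (Fin n) (H →L[ℂ] H)) (x : PiLp 2 (fun _ : Fin n => H)) (i : Fin n) :
    matrixOp A x i = ∑ j, A i j (x j) := by
  simp [matrixOp]

theorem norm_matrixOp_le {H : Type*} [NormedAddCommGroup H] [InnerProductSpace ℂ H] {n : ℕ}
    (A : Matrix (Fin n) (Fin n) (H →L[ℂ] H)) : ‖matrixOp A‖ ≤ ∑ k, ∑ l, ‖A k l‖ := by
  refine ContinuousLinearMap.opNorm_le_bound _
    (Finset.sum_nonneg fun k _ => Finset.sum_nonneg fun l _ => norm_nonneg _) fun x => ?_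
  have h1 : ∀ k, ‖matrixOp A x k‖ ≤ (∑ l, ‖A k l‖) * ‖x‖ := by
    intro k
    rw [matrixOp_apply, Finset.sum_mul]
    exact norm_sum_le_of_le _ fun l _ => (A k l).le_opNorm_of_le (PiLp.norm_apply_le x l)
  calc ‖matrixOp A x‖ = √(∑ k, ‖matrixOp A x k‖ ^ 2) := PiLp.norm_eq_of_L2 _
    _ ≤ ∑ k, ‖matrixOp A x k‖ := by
      rw [Real.sqrt_le_left (Finset.sum_nonneg fun k _ => norm_nonneg _)]
      exact Finset.sum_sq_le_sq_sum_of_nonneg fun k _ => norm_nonneg _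
    _ ≤ (∑ k, ∑ l, ‖A k l‖) * ‖x‖ := by
      rw [Finset.sum_mul]
      exact Finset.sum_le_sum fun k _ => h1 k

theorem tendsto_norm_toLp_ultraMk {I : Type*} (U : Ultrafilter I) {H : I → Type*}
    [∀ i, NormedAddCommGroup (H i)] [∀ i, InnerProductSpace ℂ (H i)] {n : ℕ}
    (x : Fin n → lp H ∞) :
    Tendsto (fun i => ‖WithLp.toLp 2 fun k => x k i‖) U
      (𝓝 ‖WithLp.toLp 2 fun k => ultraMk U (x k)‖) := by
  simp only [PiLp.norm_eq_of_L2]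
  exact ((tendsto_finsetSum _ fun k _ => (tendsto_norm_ultraMk (x k)).pow 2)).sqrt

theorem tendsto_norm_matrixOp_ultraOp {I : Type*} (U : Ultrafilter I) {H : I → Type*}
    [∀ i, NormedAddCommGroup (H i)] [∀ i, InnerProductSpace ℂ (H i)] {n : ℕ}
    (A : Matrix (Fin n) (Fin n) (lp (fun i => H i →L[ℂ] H i) ∞)) :
    Tendsto (fun i => ‖matrixOp fun k l => A k l i‖) U
      (𝓝 ‖matrixOp fun k l => ultraOp U (A k l)‖) := by
  obtain ⟨L, hL⟩ := exists_tendsto_of_bdd (U := U) (M := ∑ k, ∑ l, ‖A k l‖)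
    (fun i => norm_nonneg (matrixOp fun k l => A k l i))
    (fun i => (norm_matrixOp_le _).trans (Finset.sum_le_sum fun k _ =>
      Finset.sum_le_sum fun l _ => lp.norm_apply_le_norm (by simp) (A k l) i))
  have hL0 : 0 ≤ L := ge_of_tendsto' hL fun i => norm_nonneg _
  have hA : ∀ x : Fin n → lp H ∞,
      (matrixOp fun k l => ultraOp U (A k l)) (WithLp.toLp 2 fun k => ultraMk U (x k)) =
        WithLp.toLp 2 fun k => ultraMk U (∑ l, applyFam (A k l) (x l)) := by
    intro x
    ext k
    refine (matrixOp_apply _ _ k).trans ?_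
    change _ = ultraMk U (∑ l, applyFam (A k l) (x l))
    rw [map_sum]
    rfl
  have hB : ∀ (x : Fin n → lp H ∞) (i : I),
      (matrixOp fun k l => A k l i) (WithLp.toLp 2 fun k => x k i) =
        WithLp.toLp 2 fun k => (∑ l, applyFam (A k l) (x l) : lp H ∞) i := by
    intro x i
    ext k
    refine (matrixOp_apply _ _ k).trans ?_
    change _ = (∑ l, applyFam (A k l) (x l) : lp H ∞) i
    rw [lp.coeFn_sum, Finset.sum_apply]
    rfl
  suffices h : ‖matrixOp fun k l => ultraOp U (A k l)‖ = L by rwa [h]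
  apply le_antisymm
  · refine ContinuousLinearMap.opNorm_le_bound _ hL0 fun x => ?_
    choose y hy using fun k => ultraMk_surjective (x k)
    have hx : x = WithLp.toLp 2 fun k => ultraMk U (y k) := by ext k; exact (hy k).symm
    rw [hx, hA]
    refine le_of_tendsto_of_tendsto' (tendsto_norm_toLp_ultraMk U _)
      (hL.mul (tendsto_norm_toLp_ultraMk U y)) fun i => ?_
    rw [← hB]
    exact ContinuousLinearMap.le_opNorm _ _
  · refine le_of_forall_pos_le_add fun ε hε => ?_
    have hex : ∀ i, ∃ x : PiLp 2 (fun _ : Fin n => H i), ‖x‖ ≤ 1 ∧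
        ‖matrixOp fun k l => A k l i‖ - ε ≤ ‖(matrixOp fun k l => A k l i) x‖ := by
      intro i
      by_cases h0 : ‖matrixOp fun k l => A k l i‖ - ε < 0
      · exact ⟨0, by simp, by simpa using h0.le⟩
      · obtain ⟨x, hx, hlt⟩ := (matrixOp fun k l => A k l i).exists_lt_apply_of_lt_opNorm
          (show ‖matrixOp fun k l => A k l i‖ - ε < ‖matrixOp fun k l => A k l i‖ by linarith)
        exact ⟨x, hx.le, hlt.le⟩
    choose x hx hax using hex
    let y : Fin n → lp H ∞ := fun k => ⟨fun i => x i k, memℓp_infty ⟨1, by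
      rintro _ ⟨i, rfl⟩
      exact (PiLp.norm_apply_le (x i) k).trans (hx i)⟩⟩
    have h1 : ‖WithLp.toLp 2 fun k => ultraMk U (y k)‖ ≤ 1 :=
      le_of_tendsto' (tendsto_norm_toLp_ultraMk U y) fun i => hx i
    have h2 : L - ε ≤ ‖(matrixOp fun k l => ultraOp U (A k l))
        (WithLp.toLp 2 fun k => ultraMk U (y k))‖ := by
      rw [hA]
      refine le_of_tendsto_of_tendsto' (hL.sub_const ε) (tendsto_norm_toLp_ultraMk U _)
        fun i => ?_
      rw [← hB]
      exact hax i
    have h3 := (matrixOp fun k l => ultraOp U (A k l)).le_opNorm_of_le h1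
    linarith

/-- The norm of `M_n(E)`, for an operator space `E ⊆ B(H)`: that of `B(ℓ₂ⁿ(H))`. -/
def matrixNorm (E : OperatorSpace.{u}) {n : ℕ} (A : Matrix (Fin n) (Fin n) E) : ℝ :=
  ‖matrixOp (A.map E.val)‖

/-- The norm of `M_n(∏ F i / U)` is the limit of the norms of `M_n(F i)`: the matrix norms of the
ultraproduct are given by `M_n(∏ F i / U) = ∏ M_n(F i) / U`. -/
theorem tendsto_matrixNorm_opMk {I : Type w} (U : Ultrafilter I) (F : I → OperatorSpace.{v}) {n : ℕ}
    (A : Matrix (Fin n) (Fin n) (lp (fun i => F i) ∞)) :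
    Tendsto (fun i => matrixNorm (F i) (A.map fun f => f i)) U
      (𝓝 (matrixNorm (opUltraproduct U F) (A.map (opMk U F)))) :=
  tendsto_norm_matrixOp_ultraOp U fun k l => valFam F (A k l)

/-- The completely bounded norm `sup_n ‖I_{M_n} ⊗ u : M_n(E) → M_n(F)‖` of a linear map
(it is `∞` if the map is not completely bounded). -/
def cbNorm {E : OperatorSpace.{u}} {F : OperatorSpace.{v}} (u : E →ₗ[ℂ] F) : ℝ≥0∞ :=
  ⨆ (n : ℕ) (A : Matrix (Fin n) (Fin n) E) (_ : matrixNorm E A ≤ 1),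
    ENNReal.ofReal (matrixNorm F (A.map u))

/-- The completely bounded analogue of the Banach-Mazur distance. -/
def dcb (E : OperatorSpace.{u}) (F : OperatorSpace.{v}) : ℝ≥0∞ :=
  ⨅ u : E ≃ₗ[ℂ] F, cbNorm u.toLinearMap * cbNorm u.symm.toLinearMap

/-- The Hilbert space `ℓ₂`. -/
abbrev HilbertSeq : Type := lp (fun _ : ℕ => ℂ) 2

/-- The infimum of `dcb E F` over all operator spaces `F` contained in the space of compact
operators on `ℓ₂`. -/
def dSK (E : OperatorSpace.{u}) : ℝ≥0∞ :=
  ⨅ (F : Submodule ℂ (HilbertSeq →L[ℂ] HilbertSeq))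
    (hF : IsClosed (F : Set (HilbertSeq →L[ℂ] HilbertSeq)))
    (_ : ∀ T ∈ F, IsCompactOperator T), dcb E ⟨HilbertSeq, F, hF⟩

end CB

end OpSpace

end

noncomputable section

namespace OpSpace

open OperatorSpace

/-! Fix a basis `e k` of `E`. Elements on both sides of `v_E` are sums `∑ e k ⊗ f k`, so everything
is a comparison of norms of operators `∑ a k ⊗ b k` (`tensorSum`). If the `a k` are compressed to a
subspace with an orthonormal basis of `n` vectors, that norm becomes the norm of an `n × n` matrix
of linear combinations of the `b k`. Norms of matrices of fixed size pass to ultraproducts, hence so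
do the compressed norms (`tendsto_norm_tensorSum_compress`). The full norm is the supremum of the
compressed ones, and a supremum of limits is at most the limit of the suprema: this is `‖v_E‖ ≤ 1`.

The reverse estimate needs one compression that works for all indices at once. If `E` is close to a
space of compact operators, move the `e k` there: finitely many compact operators are uniformly
approximated by a single finite dimensional compression, with an error independent of the index.
Moving there and back costs `‖u‖_cb ‖u⁻¹‖_cb`, which gives (i) → (ii)
(`norm_canonicalEquiv_symm_le_of_compact`).

For (iii) → (i), let `C' > C`. By separability an increasing sequence of finite dimensional
subspaces `W n` determines `‖∑ e k ⊗ b k‖` for matrix coefficients `b` of every size. If no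
compression to `W n` were bounded below by `1/C'` at all matrix levels, there would be coefficients
`b n` giving norm `1` whose compressions to `W n` have norm at most `1/C'`. They span spaces of
dimension at most `dim E`; along a nonprincipal ultrafilter on a countable set, the limit element
has norm at most `1/C'` in `E ⊗_min (∏ F i / U)`, while its inverse image under `v_E` has norm `1`.
This contradicts `‖v_E⁻¹‖ ≤ C`. So some compression is a `C'`-complete isomorphism
(`exists_norm_tensorSum_le_mul_compress`), and its image embeds in the finite rank operators on `ℓ₂`
(`dSK_le_of_compress`). -/

theorem norm_comp_comp_le {X Y Z V : Type*} [NormedAddCommGroup X] [NormedSpace ℂ X]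
    [NormedAddCommGroup Y] [NormedSpace ℂ Y] [NormedAddCommGroup Z] [NormedSpace ℂ Z]
    [NormedAddCommGroup V] [NormedSpace ℂ V]
    {R : Z →L[ℂ] V} {S : X →L[ℂ] Y} (T : Y →L[ℂ] Z) (hR : ‖R‖ ≤ 1) (hS : ‖S‖ ≤ 1) :
    ‖R ∘L T ∘L S‖ ≤ ‖T‖ := by
  calc ‖R ∘L T ∘L S‖ ≤ ‖R‖ * (‖T‖ * ‖S‖) :=
        (ContinuousLinearMap.opNorm_comp_le _ _).trans
          (mul_le_mul_of_nonneg_left (ContinuousLinearMap.opNorm_comp_le _ _) (norm_nonneg _))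
    _ ≤ 1 * (‖T‖ * 1) := by gcongr
    _ = ‖T‖ := by ring

/-! ### Compressions to subspaces -/

section Compression

variable {H : Type*} [NormedAddCommGroup H] [InnerProductSpace ℂ H]

/-- The compression `P a P` of an operator, where `P` is the orthogonal projection on `W`. -/
def compress (W : Submodule ℂ H) [W.HasOrthogonalProjection] :
    (H →L[ℂ] H) →ₗ[ℂ] (H →L[ℂ] H) where
  toFun a := W.starProjection ∘L a ∘L W.starProjection
  map_add' a b := by ext; simp
  map_smul' c a := by ext; simp

theorem compress_apply (W : Submodule ℂ H) [W.HasOrthogonalProjection] (a : H →L[ℂ] H) :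
    compress W a = W.starProjection ∘L a ∘L W.starProjection := rfl

theorem compress_compress_of_le {V W : Submodule ℂ H} [V.HasOrthogonalProjection]
    [W.HasOrthogonalProjection] (h : V ≤ W) (a : H →L[ℂ] H) :
    compress V (compress W a) = compress V a := by
  have h1 := Submodule.starProjection_comp_starProjection_of_le h
  have h2 : W.starProjection ∘L V.starProjection = V.starProjection := by
    ext x
    exact Submodule.starProjection_eq_self_iff.2 (h (V.starProjection_apply_mem x))
  calc compress V (compress W a)
      = (V.starProjection ∘L W.starProjection) ∘L a ∘L (W.starProjection ∘L V.starProjection) := rfl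
    _ = compress V a := by rw [h1, h2]; rfl

theorem norm_compress_le (W : Submodule ℂ H) [W.HasOrthogonalProjection] (a : H →L[ℂ] H) :
    ‖compress W a‖ ≤ ‖a‖ :=
  norm_comp_comp_le a W.starProjection_norm_le W.starProjection_norm_le

end Compression

/-! ### Norms of `∑ a k ⊗ b k` and compression of one leg -/

section TensorSum

variable {H K : Type*} [NormedAddCommGroup H] [InnerProductSpace ℂ H]
  [NormedAddCommGroup K] [InnerProductSpace ℂ K] {ι : Type*} [Fintype ι]

/-- The operator `∑ a k ⊗ b k` on `H ⊗₂ K`. -/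
def tensorSum (a : ι → H →L[ℂ] H) (b : ι → K →L[ℂ] K) : HilbertTensor H K →L[ℂ] HilbertTensor H K :=
  ∑ k, opTensor (a k) (b k)

theorem opTensor_comp (a a' : H →L[ℂ] H) (b b' : K →L[ℂ] K) :
    opTensor (a ∘L a') (b ∘L b') = opTensor a b ∘L opTensor a' b' :=
  hilbertTensor_ext fun h k => by simp [opTensor_tmul]

/-- Since `(P ⊗ 1)(a ⊗ b)(P ⊗ 1) = PaP ⊗ b`, compressing the left leg compresses the whole operator,
so it cannot increase the norm. -/
theorem tensorSum_compress_left (W : Submodule ℂ H) [W.HasOrthogonalProjection]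
    (a : ι → H →L[ℂ] H) (b : ι → K →L[ℂ] K) :
    tensorSum (fun k => compress W (a k)) b =
      opTensor W.starProjection (.id ℂ K) ∘L tensorSum a b ∘L
        opTensor W.starProjection (.id ℂ K) := by
  simp only [tensorSum, ContinuousLinearMap.finsetSum_comp, ContinuousLinearMap.comp_finsetSum]
  exact Finset.sum_congr rfl fun k _ => by rw [← opTensor_comp, ← opTensor_comp]; rfl

theorem norm_opTensor_starProjection_le (W : Submodule ℂ H) [W.HasOrthogonalProjection] :
    ‖opTensor W.starProjection (.id ℂ K)‖ ≤ 1 := by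
  refine (norm_opTensor_le _ _).trans ?_
  have h1 := W.starProjection_norm_le
  have h2 : ‖ContinuousLinearMap.id ℂ K‖ ≤ 1 := ContinuousLinearMap.norm_id_le
  nlinarith [norm_nonneg W.starProjection, norm_nonneg (ContinuousLinearMap.id ℂ K)]

theorem norm_tensorSum_compress_left_le (W : Submodule ℂ H) [W.HasOrthogonalProjection]
    (a : ι → H →L[ℂ] H) (b : ι → K →L[ℂ] K) :
    ‖tensorSum (fun k => compress W (a k)) b‖ ≤ ‖tensorSum a b‖ := by
  rw [tensorSum_compress_left]
  exact norm_comp_comp_le _ (norm_opTensor_starProjection_le W) (norm_opTensor_starProjection_le W)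

/-- `P ⊗ 1` is self-adjoint because `P` is; it suffices to check this on elementary tensors and
extend by density. -/
theorem opTensor_starProjection_inner (W : Submodule ℂ H) [W.HasOrthogonalProjection]
    (x y : HilbertTensor H K) :
    inner ℂ (opTensor W.starProjection (.id ℂ K) x) y =
      inner ℂ x (opTensor W.starProjection (.id ℂ K) y) := by
  refine denseRange_toHilbertTensor.induction_on₂
    (p := fun x y : HilbertTensor H K => inner ℂ (opTensor W.starProjection (.id ℂ K) x) y =
      inner ℂ x (opTensor W.starProjection (.id ℂ K) y))
    (isClosed_eq (by fun_prop) (by fun_prop)) (fun x y => ?_) x y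
  induction x using TensorProduct.induction_on with
  | zero => simp
  | add x y hx hy => simp only [map_add, inner_add_left, hx, hy]
  | tmul h k =>
    induction y using TensorProduct.induction_on with
    | zero => simp
    | add x y hx hy => simp only [map_add, inner_add_right, hx, hy]
    | tmul h' k' =>
      rw [opTensor_tmul, opTensor_tmul, LinearIsometry.inner_map_map, LinearIsometry.inner_map_map,
        TensorProduct.inner_tmul, TensorProduct.inner_tmul,
        Submodule.inner_starProjection_left_eq_right]
      rfl

/-- An algebraic tensor involves only finitely many vectors of `H`. -/
theorem exists_opTensor_starProjection_eq (z : H ⊗[ℂ] K) :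
    ∃ s : Finset H, ∀ (W : Submodule ℂ H) [W.HasOrthogonalProjection], (∀ x ∈ s, x ∈ W) →
      opTensor W.starProjection (.id ℂ K) (toHilbertTensor z) = toHilbertTensor z := by
  classical
  induction z using TensorProduct.induction_on with
  | zero => exact ⟨∅, fun W _ _ => by simp⟩
  | tmul h k =>
    refine ⟨{h}, fun W _ hW => ?_⟩
    rw [opTensor_tmul, Submodule.starProjection_eq_self_iff.2 (hW h (by simp))]
    rfl
  | add x y hx hy =>
    obtain ⟨s, hs⟩ := hx
    obtain ⟨t, ht⟩ := hy
    refine ⟨s ∪ t, fun W _ hW => ?_⟩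
    rw [map_add, map_add, hs W fun x hx => hW x (Finset.mem_union_left _ hx),
      ht W fun x hx => hW x (Finset.mem_union_right _ hx)]

/-- The norm of `∑ a k ⊗ b k` is determined by the compressions of the `a k` to finite dimensional
subspaces. -/
theorem norm_tensorSum_le_of_compress_left {a : ι → H →L[ℂ] H} {b : ι → K →L[ℂ] K} {c : ℝ}
    (hc : 0 ≤ c) (h : ∀ s : Finset H,
      ‖tensorSum (fun k => compress (Submodule.span ℂ (s : Set H)) (a k)) b‖ ≤ c) :
    ‖tensorSum a b‖ ≤ c := by
  classical
  -- It suffices to bound the sesquilinear form on algebraic tensors. There both arguments are fixed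
  -- by `P ⊗ 1` for one finite dimensional `W`, so the form agrees with that of the compression.
  have key : ∀ x y : HilbertTensor H K, ‖inner ℂ (tensorSum a b x) y‖ ≤ c * ‖x‖ * ‖y‖ := by
    intro x y
    refine denseRange_toHilbertTensor.induction_on₂
      (p := fun x y : HilbertTensor H K => ‖inner ℂ (tensorSum a b x) y‖ ≤ c * ‖x‖ * ‖y‖)
      (isClosed_le (by fun_prop) (by fun_prop)) (fun x y => ?_) x y
    obtain ⟨s, hs⟩ := exists_opTensor_starProjection_eq x
    obtain ⟨t, ht⟩ := exists_opTensor_starProjection_eq y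
    have hsub : ∀ z ∈ s ∪ t, z ∈ Submodule.span ℂ ((s ∪ t : Finset H) : Set H) := fun z hz =>
      Submodule.subset_span hz
    have hx := hs (Submodule.span ℂ ((s ∪ t : Finset H) : Set H))
      fun z hz => hsub z (Finset.mem_union_left _ hz)
    have hy := ht (Submodule.span ℂ ((s ∪ t : Finset H) : Set H))
      fun z hz => hsub z (Finset.mem_union_right _ hz)
    have e : inner ℂ (tensorSum a b (toHilbertTensor x)) (toHilbertTensor y) =
        inner ℂ (tensorSum (fun k => compress
          (Submodule.span ℂ ((s ∪ t : Finset H) : Set H)) (a k)) b (toHilbertTensor x))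
          (toHilbertTensor y) := by
      rw [tensorSum_compress_left]
      simp only [ContinuousLinearMap.comp_apply]
      rw [opTensor_starProjection_inner, hx, hy]
    rw [e]
    refine (norm_inner_le_norm _ _).trans ?_
    gcongr
    exact ContinuousLinearMap.le_of_opNorm_le _ (h (s ∪ t)) _
  refine ContinuousLinearMap.opNorm_le_bound _ hc fun x => ?_
  -- Taking `y = T x` turns the bound on the form into `‖T x‖² ≤ c ‖x‖ ‖T x‖`.
  have h1 := key x (tensorSum a b x)
  rw [inner_self_eq_norm_sq_to_K, norm_pow, RCLike.norm_ofReal, abs_norm, pow_two] at h1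
  rcases (norm_nonneg (tensorSum a b x)).eq_or_lt with h0 | h0
  · rw [← h0]; positivity
  · exact le_of_mul_le_mul_right h1 h0

/-- The flip `h ⊗ k ↦ k ⊗ h`. -/
def flipTensor : HilbertTensor H K →L[ℂ] HilbertTensor K H :=
  (TensorProduct.commIsometry ℂ H K).toContinuousLinearEquiv.toContinuousLinearMap.completion

theorem flipTensor_apply (x : H ⊗[ℂ] K) :
    flipTensor (toHilbertTensor x) = toHilbertTensor (TensorProduct.comm ℂ H K x) :=
  ContinuousLinearMap.completion_apply_coe _ _

theorem norm_flipTensor_le : ‖(flipTensor : HilbertTensor H K →L[ℂ] HilbertTensor K H)‖ ≤ 1 := by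
  refine ContinuousLinearMap.opNorm_le_bound _ zero_le_one fun x => ?_
  refine denseRange_toHilbertTensor.induction_on
    (p := fun x : HilbertTensor H K => ‖flipTensor x‖ ≤ 1 * ‖x‖) x
    (isClosed_le (by fun_prop) (by fun_prop)) fun x => ?_
  rw [flipTensor_apply, LinearIsometry.norm_map, LinearIsometry.norm_map,
    TensorProduct.norm_comm, one_mul]

theorem tensorSum_flip (a : ι → H →L[ℂ] H) (b : ι → K →L[ℂ] K) :
    tensorSum b a = flipTensor ∘L tensorSum a b ∘L flipTensor :=
  hilbertTensor_ext fun _ _ => by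
    simp [tensorSum, flipTensor_apply, opTensor_tmul]

/-- The flip is contractive in both directions. Through this symmetry each result on the left leg
yields one on the right leg. -/
theorem norm_tensorSum_comm (a : ι → H →L[ℂ] H) (b : ι → K →L[ℂ] K) :
    ‖tensorSum a b‖ = ‖tensorSum b a‖ := by
  refine le_antisymm ?_ ?_
  · rw [tensorSum_flip b a]
    exact (norm_comp_comp_le _ norm_flipTensor_le norm_flipTensor_le)
  · rw [tensorSum_flip a b]
    exact (norm_comp_comp_le _ norm_flipTensor_le norm_flipTensor_le)

theorem norm_tensorSum_compress_right_le (W : Submodule ℂ K) [W.HasOrthogonalProjection]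
    (a : ι → H →L[ℂ] H) (b : ι → K →L[ℂ] K) :
    ‖tensorSum a fun k => compress W (b k)‖ ≤ ‖tensorSum a b‖ := by
  rw [norm_tensorSum_comm, norm_tensorSum_comm a]
  exact norm_tensorSum_compress_left_le W b a

theorem norm_tensorSum_le_of_compress_right {a : ι → H →L[ℂ] H} {b : ι → K →L[ℂ] K} {c : ℝ}
    (hc : 0 ≤ c) (h : ∀ s : Finset K,
      ‖tensorSum a fun k => compress (Submodule.span ℂ (s : Set K)) (b k)‖ ≤ c) :
    ‖tensorSum a b‖ ≤ c := by
  rw [norm_tensorSum_comm]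
  refine norm_tensorSum_le_of_compress_left hc fun s => ?_
  rw [norm_tensorSum_comm]
  exact h s

theorem norm_tensorSum_le (a : ι → H →L[ℂ] H) (b : ι → K →L[ℂ] K) :
    ‖tensorSum a b‖ ≤ ∑ k, ‖a k‖ * ‖b k‖ :=
  norm_sum_le_of_le _ fun _ _ => norm_opTensor_le _ _

theorem tensorSum_sub_left (a a' : ι → H →L[ℂ] H) (b : ι → K →L[ℂ] K) :
    tensorSum (fun k => a k - a' k) b = tensorSum a b - tensorSum a' b := by
  simp [tensorSum]

theorem tensorSum_sub_right (a : ι → H →L[ℂ] H) (b b' : ι → K →L[ℂ] K) :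
    tensorSum a (fun k => b k - b' k) = tensorSum a b - tensorSum a b' := by
  simp [tensorSum]

theorem tensorSum_smul_right (c : ℂ) (a : ι → H →L[ℂ] H) (b : ι → K →L[ℂ] K) :
    tensorSum a (fun k => c • b k) = c • tensorSum a b := by
  simp [tensorSum, Finset.smul_sum]

end TensorSum

/-! ### Compressed tensors as finite matrices -/

section MatrixSlice

variable {H K : Type*} [NormedAddCommGroup H] [InnerProductSpace ℂ H]
  [NormedAddCommGroup K] [InnerProductSpace ℂ K] {ι : Type*} [Fintype ι] {n : ℕ}

/-- `(x j)_j ↦ ∑ h j ⊗ x j`. -/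
def tmulFamily (h : Fin n → H) : PiLp 2 (fun _ : Fin n => K) →L[ℂ] HilbertTensor H K :=
  ∑ j, tmulLeft (h j) ∘L PiLp.proj 2 (fun _ : Fin n => K) j

theorem tmulFamily_apply (h : Fin n → H) (x : PiLp 2 (fun _ : Fin n => K)) :
    tmulFamily h x = ∑ j, tmulLeft (h j) (x j) := by
  simp [tmulFamily]

theorem inner_tmulLeft (h h' : H) (k k' : K) :
    inner ℂ (tmulLeft h k) (tmulLeft h' k') = inner ℂ h h' * inner ℂ k k' := by
  change inner ℂ (toHilbertTensor (h ⊗ₜ[ℂ] k)) (toHilbertTensor (h' ⊗ₜ[ℂ] k')) = _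
  rw [LinearIsometry.inner_map_map, TensorProduct.inner_tmul]

theorem norm_tmulFamily_le {h : Fin n → H} (hh : Orthonormal ℂ h) :
    ‖tmulFamily (K := K) h‖ ≤ 1 := by
  classical
  refine ContinuousLinearMap.opNorm_le_bound _ zero_le_one fun x => ?_
  rw [one_mul, ← sq_le_sq₀ (norm_nonneg _) (norm_nonneg _), PiLp.norm_sq_eq_of_L2]
  have h1 : (inner ℂ (tmulFamily h x) (tmulFamily h x) : ℂ) = ∑ j, inner ℂ (x j) (x j) := by
    rw [tmulFamily_apply, sum_inner]
    refine Finset.sum_congr rfl fun i _ => ?_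
    rw [inner_sum, Finset.sum_eq_single i]
    · rw [inner_tmulLeft, inner_self_eq_norm_sq_to_K, hh.1 i]; simp
    · intro j _ hj
      rw [inner_tmulLeft, hh.2 hj.symm, zero_mul]
    · simp
  simp only [inner_self_eq_norm_sq_to_K] at h1
  refine le_of_eq ?_
  exact_mod_cast h1

variable [CompleteSpace K]

theorem adjoint_tmulLeft_apply (ξ h : H) (k : K) :
    ContinuousLinearMap.adjoint (tmulLeft (K := K) ξ) (toHilbertTensor (h ⊗ₜ k)) =
      inner ℂ ξ h • k := by
  refine ext_inner_left ℂ fun k' => ?_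
  rw [ContinuousLinearMap.adjoint_inner_right]
  exact (inner_tmulLeft ξ h k' k).trans (by rw [inner_smul_right])

theorem adjoint_tmulFamily_apply (h : Fin n → H) (t : HilbertTensor H K) (i : Fin n) :
    ContinuousLinearMap.adjoint (tmulFamily h) t i =
      ContinuousLinearMap.adjoint (tmulLeft (h i)) t := by
  have e : ContinuousLinearMap.adjoint (tmulFamily h) t =
      WithLp.toLp 2 fun i => ContinuousLinearMap.adjoint (tmulLeft (K := K) (h i)) t := by
    refine ext_inner_left ℂ fun x => ?_
    rw [ContinuousLinearMap.adjoint_inner_right, tmulFamily_apply, sum_inner, PiLp.inner_apply]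
    exact Finset.sum_congr rfl fun i _ => (ContinuousLinearMap.adjoint_inner_right _ _ _).symm
  rw [e]

/-- With `J = tmulFamily h`, the operator `J* T J` acts on `ℓ₂ⁿ(K)`, and its entries are the slices
of `T`. -/
theorem matrixOp_slice (h : Fin n → H) (T : HilbertTensor H K →L[ℂ] HilbertTensor H K) :
    matrixOp (Matrix.of fun i j => slice (h i) (h j) T) =
      ContinuousLinearMap.adjoint (tmulFamily h) ∘L T ∘L tmulFamily h := by
  ext x i
  rw [matrixOp_apply]
  simp only [ContinuousLinearMap.comp_apply]
  rw [adjoint_tmulFamily_apply, tmulFamily_apply, map_sum, map_sum]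
  rfl

theorem slice_tensorSum (ξ η : H) (a : ι → H →L[ℂ] H) (b : ι → K →L[ℂ] K) :
    slice ξ η (tensorSum a b) = ∑ k, inner ℂ ξ (a k η) • b k := by
  simp [tensorSum, slice_opTensor]

/-- `J J*` is the sum of the rank one projections on the `h i`, tensored with the identity. -/
theorem tmulFamily_comp_adjoint {W : Submodule ℂ H} [FiniteDimensional ℂ W]
    (h : OrthonormalBasis (Fin n) ℂ W) :
    tmulFamily (fun i => (h i : H)) ∘L ContinuousLinearMap.adjoint (tmulFamily fun i => (h i : H)) =
      opTensor W.starProjection (.id ℂ K) :=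
  hilbertTensor_ext fun x k => by
    rw [opTensor_tmul, ContinuousLinearMap.comp_apply, tmulFamily_apply,
      h.starProjection_eq_sum_rankOne]
    simp only [adjoint_tmulFamily_apply, adjoint_tmulLeft_apply]
    rw [ContinuousLinearMap.id_apply, sum_apply, TensorProduct.sum_tmul, map_sum]
    refine Finset.sum_congr rfl fun i _ => ?_
    rw [map_smul, InnerProductSpace.rankOne_apply, ← TensorProduct.smul_tmul', map_smul]
    rfl

/-- For an orthonormal basis `h` of `W`, the norm of `∑ P a k P ⊗ b k`, where `P` is the projection
on `W`, is the norm of the matrix with entries `∑ ⟪h i, a k (h j)⟫ b k`. -/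
theorem norm_tensorSum_compress_left_eq {W : Submodule ℂ H} [FiniteDimensional ℂ W]
    (h : OrthonormalBasis (Fin n) ℂ W) (a : ι → H →L[ℂ] H) (b : ι → K →L[ℂ] K) :
    ‖tensorSum (fun k => compress W (a k)) b‖ =
      ‖matrixOp (Matrix.of fun i j => ∑ k, inner ℂ (h i : H) (a k (h j)) • b k)‖ := by
  have hJ : ‖tmulFamily (K := K) fun i => (h i : H)‖ ≤ 1 :=
    norm_tmulFamily_le (h.orthonormal.comp_linearIsometry W.subtypeₗᵢ)
  have hJ' : ‖ContinuousLinearMap.adjoint (tmulFamily (K := K) fun i => (h i : H))‖ ≤ 1 := by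
    rwa [LinearIsometryEquiv.norm_map]
  have e : ∀ a : ι → H →L[ℂ] H,
      matrixOp (Matrix.of fun i j => ∑ k, inner ℂ (h i : H) (a k (h j)) • b k) =
      ContinuousLinearMap.adjoint (tmulFamily (K := K) fun i => (h i : H)) ∘L
        tensorSum a b ∘L tmulFamily (fun i => (h i : H)) := by
    intro a
    rw [← matrixOp_slice]
    simp only [slice_tensorSum]
  -- The vectors `h i` lie in `W`, so compressing to `W` does not change the matrix entries.
  have e' : (Matrix.of fun i j => ∑ k, inner ℂ (h i : H) (a k (h j)) • b k) =
      Matrix.of fun i j => ∑ k, inner ℂ (h i : H) (compress W (a k) (h j)) • b k := by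
    ext1 i j
    simp only [Matrix.of_apply]
    refine Finset.sum_congr rfl fun k _ => ?_
    rw [compress_apply, ContinuousLinearMap.comp_apply, ContinuousLinearMap.comp_apply,
      ← Submodule.inner_starProjection_left_eq_right,
      Submodule.starProjection_eq_self_iff.2 (h i).2, Submodule.starProjection_eq_self_iff.2 (h j).2]
  refine le_antisymm ?_ ?_
  -- The compressed sum is `J (J* T J) J*`, with `J* T J` the matrix and `J`, `J*` contractions. The
  -- opposite inequality applies `e` to the compressed operators.
  · rw [e, tensorSum_compress_left, ← tmulFamily_comp_adjoint h]
    refine Eq.trans_le ?_ (norm_comp_comp_le _ hJ hJ')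
    simp only [ContinuousLinearMap.comp_assoc]
  · rw [e', e]
    exact norm_comp_comp_le _ hJ' hJ

end MatrixSlice

/-! ### Operators on finite dimensional spaces and matrix norms -/

section MatrixNorms

variable {H K : Type*} [NormedAddCommGroup H] [InnerProductSpace ℂ H]
  [NormedAddCommGroup K] [InnerProductSpace ℂ K] {ι : Type*} [Fintype ι] {n : ℕ}

theorem norm_tensorSum_compress_right_eq [CompleteSpace H] {W : Submodule ℂ K}
    [FiniteDimensional ℂ W] (h : OrthonormalBasis (Fin n) ℂ W) (a : ι → H →L[ℂ] H)
    (b : ι → K →L[ℂ] K) :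
    ‖tensorSum a fun k => compress W (b k)‖ =
      ‖matrixOp (Matrix.of fun i j => ∑ k, inner ℂ (h i : K) (b k (h j)) • a k)‖ := by
  rw [norm_tensorSum_comm, norm_tensorSum_compress_left_eq h]

/-- This is the case `W = ⊤`, where compression does nothing. -/
theorem norm_tensorSum_eq_matrixOp [CompleteSpace H] [FiniteDimensional ℂ K]
    (h : OrthonormalBasis (Fin n) ℂ K) (a : ι → H →L[ℂ] H) (b : ι → K →L[ℂ] K) :
    ‖tensorSum a b‖ = ‖matrixOp (Matrix.of fun i j => ∑ k, inner ℂ (h i) (b k (h j)) • a k)‖ := by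
  have e := norm_tensorSum_compress_right_eq
    (h.map (LinearIsometryEquiv.ofTop K ⊤ rfl).symm) a b
  have hb : (fun k => compress (⊤ : Submodule ℂ K) (b k)) = b := by
    funext k
    rw [compress_apply, Submodule.starProjection_top]
    rfl
  rw [hb] at e
  exact e

/-- The operator with matrix `γ` in an orthonormal basis. -/
def matrixToOp (h : OrthonormalBasis (Fin n) ℂ K) (γ : Matrix (Fin n) (Fin n) ℂ) : K →L[ℂ] K :=
  ∑ i, ∑ j, γ i j • InnerProductSpace.rankOne ℂ (h i) (h j)

theorem inner_matrixToOp (h : OrthonormalBasis (Fin n) ℂ K) (γ : Matrix (Fin n) (Fin n) ℂ)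
    (i j : Fin n) : inner ℂ (h i) (matrixToOp h γ (h j)) = γ i j := by
  classical
  have e : matrixToOp h γ (h j) = ∑ i, γ i j • h i := by
    rw [matrixToOp, sum_apply]
    refine Finset.sum_congr rfl fun i _ => ?_
    rw [sum_apply, Finset.sum_eq_single j]
    · simp
    · intro l _ hl
      simp [h.inner_eq_zero hl]
    · simp
  rw [e, inner_sum, Finset.sum_eq_single i]
  · simp [inner_smul_right]
  · intro l _ hl
    simp [inner_smul_right, h.inner_eq_zero hl.symm]
  · simp

theorem norm_toLp_map_le {R : H →L[ℂ] K} (hR : ‖R‖ ≤ 1) (x : PiLp 2 fun _ : Fin n => H) :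
    ‖WithLp.toLp 2 fun i => R (x i)‖ ≤ ‖x‖ := by
  rw [← sq_le_sq₀ (norm_nonneg _) (norm_nonneg _), PiLp.norm_sq_eq_of_L2, PiLp.norm_sq_eq_of_L2]
  refine Finset.sum_le_sum fun i _ => ?_
  have h := R.le_of_opNorm_le hR (x i)
  rw [one_mul] at h
  exact pow_le_pow_left₀ (norm_nonneg _) h 2

/-- The matrix is multiplied by the contractions `diag(R)` and `diag(S)`; thus `T ↦ R T S` is
completely contractive. -/
theorem norm_matrixOp_comp_le {R : H →L[ℂ] K} {S : K →L[ℂ] H} (hR : ‖R‖ ≤ 1) (hS : ‖S‖ ≤ 1)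
    (A : Matrix (Fin n) (Fin n) (H →L[ℂ] H)) :
    ‖matrixOp (A.map fun T => R ∘L T ∘L S)‖ ≤ ‖matrixOp A‖ := by
  refine ContinuousLinearMap.opNorm_le_bound _ (norm_nonneg (matrixOp A)) fun x => ?_
  have e : matrixOp (A.map fun T => R ∘L T ∘L S) x =
      WithLp.toLp 2 fun i => R (matrixOp A (WithLp.toLp 2 fun i => S (x i)) i) := by
    ext i
    rw [matrixOp_apply]
    simp [matrixOp_apply]
  rw [e]
  refine (norm_toLp_map_le hR _).trans ((ContinuousLinearMap.le_opNorm _ _).trans ?_)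
  gcongr
  exact norm_toLp_map_le hS x

theorem matrixOp_smul (c : ℂ) (A : Matrix (Fin n) (Fin n) (H →L[ℂ] H)) :
    matrixOp (c • A) = c • matrixOp A := by
  ext x i
  rw [matrixOp_apply]
  simp [matrixOp_apply, Finset.smul_sum]

end MatrixNorms

/-! ### Tensor norms along an ultrafilter -/

section UltraTensor

variable {I : Type*} (U : Ultrafilter I) {K : I → Type*} [∀ i, NormedAddCommGroup (K i)]
  [∀ i, InnerProductSpace ℂ (K i)] {H : Type*} [NormedAddCommGroup H] [InnerProductSpace ℂ H]
  {ι : Type*} [Fintype ι]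

theorem ultraOp_sum_smul (c : ι → ℂ) (b : ι → lp (fun i => K i →L[ℂ] K i) ∞) :
    ∑ k, c k • ultraOp U (b k) = ultraOp U (∑ k, c k • b k) := by
  let L : lp (fun i => K i →L[ℂ] K i) ∞ →ₗ[ℂ] (Ultraproduct U K →L[ℂ] Ultraproduct U K) :=
    { toFun := fun b => ultraOp U b
      map_add' := fun f g => by
        ext x
        obtain ⟨x, rfl⟩ := ultraMk_surjective x
        rfl
      map_smul' := fun c f => by
        ext x
        obtain ⟨x, rfl⟩ := ultraMk_surjective x
        rfl }
  change ∑ k, c k • L (b k) = L (∑ k, c k • b k)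
  rw [map_sum]
  simp only [map_smul]

theorem exists_ultraOp_eq_sum_smul (c : ι → ℂ) (b : ι → lp (fun i => K i →L[ℂ] K i) ∞) :
    ∃ B : lp (fun i => K i →L[ℂ] K i) ∞, (∀ i, B i = ∑ k, c k • b k i) ∧
      ultraOp U B = ∑ k, c k • ultraOp U (b k) := by
  refine ⟨∑ k, c k • b k, fun i => ?_, (ultraOp_sum_smul U c b).symm⟩
  rw [lp.coeFn_sum, Finset.sum_apply]
  rfl

variable [∀ i, CompleteSpace (K i)]

/-- Once the left leg is finite dimensional, both norms are norms of matrices of one fixed size,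
with entries that are fixed linear combinations of the `b k`; such norms pass to the ultraproduct.
-/
theorem tendsto_norm_tensorSum_compress (W : Submodule ℂ H) [FiniteDimensional ℂ W]
    (a : ι → H →L[ℂ] H) (b : ι → lp (fun i => K i →L[ℂ] K i) ∞) :
    Tendsto (fun i => ‖tensorSum (fun k => compress W (a k)) fun k => b k i‖) U
      (𝓝 ‖tensorSum (fun k => compress W (a k)) fun k => ultraOp U (b k)‖) := by
  have h := stdOrthonormalBasis ℂ W
  choose B hB hB' using fun p q =>
    exists_ultraOp_eq_sum_smul U (fun k => inner ℂ (h p : H) (a k (h q))) b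
  have h1 := tendsto_norm_matrixOp_ultraOp U B
  have e : ∀ i, ‖matrixOp fun p q => B p q i‖ =
      ‖tensorSum (fun k => compress W (a k)) fun k => b k i‖ := by
    intro i
    rw [norm_tensorSum_compress_left_eq h]
    congr 2
    ext1 p q
    exact hB p q i
  have e' : ‖matrixOp fun p q => ultraOp U (B p q)‖ =
      ‖tensorSum (fun k => compress W (a k)) fun k => ultraOp U (b k)‖ := by
    rw [norm_tensorSum_compress_left_eq h]
    congr 2
    ext1 p q
    exact hB' p q
  rw [← e']
  exact h1.congr e

/-- Each compressed norm is a limit of compressed norms, which are eventually at most `c`; then take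
the supremum over compressions. Only this inequality survives without uniformity in the index. -/
theorem norm_tensorSum_ultraOp_le {a : ι → H →L[ℂ] H} {b : ι → lp (fun i => K i →L[ℂ] K i) ∞}
    {c : ℝ} (h : ∀ᶠ i in U, ‖tensorSum a fun k => b k i‖ ≤ c) :
    ‖tensorSum a fun k => ultraOp U (b k)‖ ≤ c := by
  obtain ⟨i, hi⟩ := h.exists
  refine norm_tensorSum_le_of_compress_left ((norm_nonneg _).trans hi) fun s => ?_
  refine le_of_tendsto (tendsto_norm_tensorSum_compress U _ a b) ?_
  filter_upwards [h] with i hi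
  exact (norm_tensorSum_compress_left_le _ _ _).trans hi

end UltraTensor

/-! ### Completely bounded maps -/

section CbNorm

variable {E : OperatorSpace.{u}} {F : OperatorSpace.{v}}

theorem matrixNorm_smul (c : ℂ) {n : ℕ} (A : Matrix (Fin n) (Fin n) E) :
    matrixNorm E (c • A) = ‖c‖ * matrixNorm E A := by
  have e : (c • A).map E.val = c • A.map E.val := by
    ext1 i j
    exact map_smul E.val c (A i j)
  rw [matrixNorm, e, matrixOp_smul, norm_smul, matrixNorm]

theorem matrixNorm_map_le_cbNorm {u : E →ₗ[ℂ] F} (hu : cbNorm u ≠ ⊤) {n : ℕ}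
    (A : Matrix (Fin n) (Fin n) E) :
    matrixNorm F (A.map u) ≤ (cbNorm u).toReal * matrixNorm E A := by
  -- Scaling by `t` strictly above the norm of `A` avoids dividing by a norm that may vanish.
  have key : ∀ t : ℝ, matrixNorm E A < t → matrixNorm F (A.map u) ≤ (cbNorm u).toReal * t := by
    intro t ht
    have ht0 : 0 < t := (norm_nonneg _).trans_lt ht
    have h1 : matrixNorm E (((t⁻¹ : ℝ) : ℂ) • A) ≤ 1 := by
      rw [matrixNorm_smul, Complex.norm_real, Real.norm_of_nonneg (inv_nonneg.2 ht0.le),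
        inv_mul_le_one₀ ht0]
      exact ht.le
    have h2 : ENNReal.ofReal (matrixNorm F ((((t⁻¹ : ℝ) : ℂ) • A).map u)) ≤ cbNorm u :=
      le_iSup_of_le n (le_iSup_of_le _ (le_iSup_of_le h1 le_rfl))
    have e : (((t⁻¹ : ℝ) : ℂ) • A).map u = ((t⁻¹ : ℝ) : ℂ) • A.map u := by
      ext1 i j
      exact map_smul u _ (A i j)
    rw [ENNReal.ofReal_le_iff_le_toReal hu, e, matrixNorm_smul, Complex.norm_real,
      Real.norm_of_nonneg (inv_nonneg.2 ht0.le), inv_mul_le_iff₀ ht0, mul_comm] at h2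
    exact h2
  have hlim : Tendsto (fun t : ℝ => (cbNorm u).toReal * t) (𝓝[>] matrixNorm E A)
      (𝓝 ((cbNorm u).toReal * matrixNorm E A)) :=
    ((continuous_const.mul continuous_id).tendsto _).mono_left nhdsWithin_le_nhds
  refine ge_of_tendsto hlim ?_
  filter_upwards [self_mem_nhdsWithin] with t ht
  exact key t ht

theorem cbNorm_le {u : E →ₗ[ℂ] F} {c : ℝ} (hc : 0 ≤ c)
    (h : ∀ (n : ℕ) (A : Matrix (Fin n) (Fin n) E), matrixNorm F (A.map u) ≤ c * matrixNorm E A) :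
    cbNorm u ≤ ENNReal.ofReal c :=
  iSup_le fun n => iSup_le fun A => iSup_le fun hA => ENNReal.ofReal_le_ofReal
    ((h n A).trans (mul_le_of_le_one_right hc hA))

/-- This is `‖u ⊗ id‖ ≤ ‖u‖_cb` for coefficients on any Hilbert space: compressing the right leg to
`n` dimensions leaves an `n × n` matrix over `E`, to which the definition of the cb norm applies. -/
theorem norm_tensorSum_map_le {K : Type*} [NormedAddCommGroup K] [InnerProductSpace ℂ K]
    [CompleteSpace K] {ι : Type*} [Fintype ι] {u : E →ₗ[ℂ] F} (hu : cbNorm u ≠ ⊤)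
    (e : ι → E) (b : ι → K →L[ℂ] K) :
    ‖tensorSum (fun k => F.val (u (e k))) b‖ ≤
      (cbNorm u).toReal * ‖tensorSum (fun k => E.val (e k)) b‖ := by
  refine norm_tensorSum_le_of_compress_right (by positivity) fun s => ?_
  have h := stdOrthonormalBasis ℂ (Submodule.span ℂ (s : Set K))
  have h1 := matrixNorm_map_le_cbNorm hu (Matrix.of fun i j =>
    ∑ k, inner ℂ (h i : K) (b k (h j)) • e k)
  refine le_trans ?_ (h1.trans (mul_le_mul_of_nonneg_left ?_ ENNReal.toReal_nonneg))
  · rw [norm_tensorSum_compress_right_eq h]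
    refine le_of_eq ?_
    rw [matrixNorm]
    congr 2
    ext1 i j
    simp
  · refine le_trans (le_of_eq ?_) (norm_tensorSum_compress_right_le
      (Submodule.span ℂ (s : Set K)) _ _)
    rw [norm_tensorSum_compress_right_eq h, matrixNorm]
    congr 2
    ext1 i j
    simp

end CbNorm

/-! ### The norm of `v_E` -/

section CanonicalNorm

variable {I : Type w} (U : Ultrafilter I) (E : OperatorSpace.{u}) (F : I → OperatorSpace.{v})
  [FiniteDimensional ℂ E]

theorem tendsto_norm_tensorSum_famEquiv (f : Fin (Module.finrank ℂ E) → lp (fun i => F i) ∞) :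
    Tendsto (fun i => ‖tensorSum (fun k => E.val (basisOf E k)) fun k => (F i).val (f k i)‖) U
      (𝓝 ‖ultraMk U (famEquiv (∑ k, basisOf E k ⊗ₜ[ℂ] f k))‖) := by
  refine (tendsto_norm_ultraMk _).congr fun i => ?_
  rw [← (minVal E (F i)).norm_map]
  exact congrArg norm (toFam_sum f i)

/-- Together with the preceding limit formula, this reduces every estimate on `v_E` and its inverse
to norms of `tensorSum`. -/
theorem norm_canonicalEquiv_famEquiv (f : Fin (Module.finrank ℂ E) → lp (fun i => F i) ∞) :
    ‖canonicalEquiv U E F (ultraMk U (famEquiv (∑ k, basisOf E k ⊗ₜ[ℂ] f k)))‖ =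
      ‖tensorSum (fun k => E.val (basisOf E k)) fun k => ultraOp U (valFam F (f k))‖ := by
  have e : canonicalEquiv U E F (ultraMk U (famEquiv (∑ k, basisOf E k ⊗ₜ[ℂ] f k))) =
    toMin U E F (∑ k, basisOf E k ⊗ₜ[ℂ] f k) := canonicalMap_famEquiv U E F _
  rw [e, ← (minVal E (opUltraproduct U F)).norm_map]
  exact congrArg norm (toMin_sum U f)

theorem exists_eq_ultraMk_famEquiv (x : Ultraproduct U fun i => minTensor E (F i)) :
    ∃ f : Fin (Module.finrank ℂ E) → lp (fun i => F i) ∞,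
      x = ultraMk U (famEquiv (∑ k, basisOf E k ⊗ₜ[ℂ] f k)) := by
  obtain ⟨x, rfl⟩ := ultraMk_surjective x
  obtain ⟨x, rfl⟩ := famEquiv.surjective x
  obtain ⟨f, rfl⟩ := exists_sum_tmul x
  exact ⟨f, rfl⟩

theorem norm_canonicalEquiv_le (x : Ultraproduct U fun i => minTensor E (F i)) :
    ‖canonicalEquiv U E F x‖ ≤ ‖x‖ := by
  obtain ⟨f, rfl⟩ := exists_eq_ultraMk_famEquiv U E F x
  rw [norm_canonicalEquiv_famEquiv]
  refine le_of_forall_gt_imp_ge_of_dense fun c hc => ?_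
  refine norm_tensorSum_ultraOp_le U ?_
  filter_upwards [(tendsto_norm_tensorSum_famEquiv U E F f).eventually (gt_mem_nhds hc)] with i hi
  exact hi.le

end CanonicalNorm

/-! ### Compact operators and finite dimensional compressions -/

section Compact

variable {H : Type*} [NormedAddCommGroup H] [InnerProductSpace ℂ H] [CompleteSpace H]

/-- A compact operator is approximated in norm by its compressions to large finite dimensional
subspaces. -/
theorem exists_norm_sub_compress_le {f : H →L[ℂ] H} (hf : IsCompactOperator f) {ε : ℝ}
    (hε : 0 < ε) : ∃ V : Submodule ℂ H, FiniteDimensional ℂ V ∧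
      ∀ (W : Submodule ℂ H) [W.HasOrthogonalProjection], V ≤ W → ‖f - compress W f‖ ≤ ε := by
  -- The image of the unit ball has a finite `ε / 2`-net; projecting on its span `V` moves `f x` by
  -- at most `ε / 2`.
  obtain ⟨S, hS, hfS⟩ := hf.image_closedBall_subset_compact (f := f.toLinearMap) 1
  obtain ⟨t, htf, hSt⟩ := Metric.totallyBounded_iff.1 hS.totallyBounded (ε / 2) (half_pos hε)
  have : FiniteDimensional ℂ (Submodule.span ℂ t) := FiniteDimensional.span_of_finite ℂ htf
  set V : Submodule ℂ H := Submodule.span ℂ t with hV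
  have h1 : ‖f - V.starProjection ∘L f‖ ≤ ε / 2 := by
    refine ContinuousLinearMap.opNorm_le_of_unit_norm (half_pos hε).le fun x hx => ?_
    have hfx : f x ∈ S := hfS ⟨x, by simp [hx], rfl⟩
    obtain ⟨y, hy, hyx⟩ := Set.mem_iUnion₂.1 (hSt hfx)
    rw [Metric.mem_ball, dist_eq_norm] at hyx
    change ‖f x - V.starProjection (f x)‖ ≤ ε / 2
    rw [Submodule.starProjection_minimal]
    refine (ciInf_le ⟨0, ?_⟩ (⟨y, Submodule.subset_span hy⟩ : V)).trans hyx.le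
    rintro _ ⟨w, rfl⟩
    exact norm_nonneg _
  -- `P_V f` has range in `V` and its adjoint has range in `f*(V)`. If `W` contains both,
  -- compression to `W` fixes `P_V f`, and the remainder `f - P_V f` and its compression contribute
  -- `ε / 2` each.
  refine ⟨V ⊔ V.map (ContinuousLinearMap.adjoint f).toLinearMap, inferInstance, fun W _ hW => ?_⟩
  have h2 : compress W (V.starProjection ∘L f) = V.starProjection ∘L f := by
    ext x
    change W.starProjection (V.starProjection (f (W.starProjection x))) = V.starProjection (f x)
    rw [Submodule.starProjection_eq_self_iff.2
      (hW (Submodule.mem_sup_left (V.starProjection_apply_mem _))), ← sub_eq_zero, ← map_sub,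
      ← map_sub, ← inner_self_eq_zero (𝕜 := ℂ), Submodule.inner_starProjection_left_eq_right,
      Submodule.starProjection_eq_self_iff.2 (V.starProjection_apply_mem _),
      ← ContinuousLinearMap.adjoint_inner_right, ← neg_sub, inner_neg_left,
      W.starProjection_inner_eq_zero, neg_zero]
    exact hW (Submodule.mem_sup_right ⟨_, V.starProjection_apply_mem _, rfl⟩)
  have h3 : f - compress W f =
      (f - V.starProjection ∘L f) - compress W (f - V.starProjection ∘L f) := by
    rw [map_sub, h2]
    abel
  rw [h3]
  have h4 := norm_compress_le W (f - V.starProjection ∘L f)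
  exact (norm_sub_le _ _).trans (by linarith)

theorem exists_forall_norm_sub_compress_le {ι : Type*} [Finite ι] {f : ι → H →L[ℂ] H}
    (hf : ∀ k, IsCompactOperator (f k)) {ε : ℝ} (hε : 0 < ε) :
    ∃ W : Submodule ℂ H, ∃ _ : FiniteDimensional ℂ W, ∀ k, ‖f k - compress W (f k)‖ ≤ ε := by
  choose V hV h using fun k => exists_norm_sub_compress_le (hf k) hε
  have hfin : FiniteDimensional ℂ (⨆ k, V k : Submodule ℂ H) := Submodule.finiteDimensional_iSup V
  exact ⟨⨆ k, V k, hfin, fun k => h k _ (le_iSup V k)⟩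

end Compact

/-! ### From compact operators to the bound on the inverse of `v_E` -/

section Converse

theorem eq_zero_of_matrixNorm_le_zero {E : OperatorSpace.{u}} {a : E}
    (h : matrixNorm E (Matrix.of fun _ _ : Fin 1 => a) ≤ 0) : a = 0 := by
  have h0 := norm_le_zero_iff.1 h
  refine val_injective ?_
  rw [map_zero]
  ext x
  have h1 := congrArg (fun T => T (WithLp.toLp 2 fun _ => x) 0) h0
  simp only [matrixOp_apply] at h1
  simpa using h1

/-- Since `0 * ⊤ = 0` in `ℝ≥0∞`, a finite product of cb norms has finite factors only once zero
factors are excluded. A zero factor forces `E = 0`, a case treated separately. -/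
theorem eq_zero_of_cbNorm_eq_zero {E : OperatorSpace.{u}} {F : OperatorSpace.{v}} {u : E →ₗ[ℂ] F}
    (hu : cbNorm u = 0) : u = 0 := by
  ext a
  have h := matrixNorm_map_le_cbNorm (hu.trans_ne ENNReal.zero_ne_top)
    (Matrix.of fun _ _ : Fin 1 => a)
  rw [hu, ENNReal.toReal_zero, zero_mul] at h
  exact eq_zero_of_matrixNorm_le_zero h

variable {I : Type w} (U : Ultrafilter I) (E : OperatorSpace.{u}) (F : I → OperatorSpace.{v})
  [FiniteDimensional ℂ E]

theorem norm_canonicalEquiv_symm_le_of_subsingleton [Subsingleton E]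
    (y : minTensor E (opUltraproduct U F)) : ‖(canonicalEquiv U E F).symm y‖ ≤ 0 := by
  obtain ⟨f, hf⟩ := exists_eq_ultraMk_famEquiv U E F ((canonicalEquiv U E F).symm y)
  rw [hf]
  refine le_of_tendsto' (tendsto_norm_tensorSum_famEquiv U E F f) fun i => ?_
  refine (norm_tensorSum_le _ _).trans (Finset.sum_nonpos fun k _ => ?_)
  rw [Subsingleton.elim (basisOf E k) 0]
  simp

theorem norm_canonicalEquiv_symm_le_of_compact {G : OperatorSpace.{0}}
    (hG : ∀ T ∈ G.space, IsCompactOperator T) (u : E ≃ₗ[ℂ] G)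
    (hu : cbNorm u.toLinearMap ≠ ⊤) (hu' : cbNorm u.symm.toLinearMap ≠ ⊤)
    (y : minTensor E (opUltraproduct U F)) :
    ‖(canonicalEquiv U E F).symm y‖ ≤
      (cbNorm u.toLinearMap).toReal * (cbNorm u.symm.toLinearMap).toReal * ‖y‖ := by
  obtain ⟨f, hf⟩ := exists_eq_ultraMk_famEquiv U E F ((canonicalEquiv U E F).symm y)
  have hy : y = canonicalEquiv U E F (ultraMk U (famEquiv (∑ k, basisOf E k ⊗ₜ[ℂ] f k))) := by
    rw [← hf, LinearEquiv.apply_symm_apply]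
  rw [hf, hy, norm_canonicalEquiv_famEquiv]
  set α := (cbNorm u.toLinearMap).toReal with hα
  set β := (cbNorm u.symm.toLinearMap).toReal with hβ
  have hα0 : 0 ≤ α := ENNReal.toReal_nonneg
  have hβ0 : 0 ≤ β := ENNReal.toReal_nonneg
  -- The constant `β` is the cost of coming back from `G`, `α` that of going there, and the last
  -- term is the compression error. That error is uniform in `i`, so the limit may be taken for the
  -- single compression to `W`.
  have key : ∀ ε : ℝ, 0 < ε → ‖ultraMk U (famEquiv (∑ k, basisOf E k ⊗ₜ[ℂ] f k))‖ ≤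
      β * (α * ‖tensorSum (fun k => E.val (basisOf E k)) fun k => ultraOp U (valFam F (f k))‖ +
        ε * ∑ k, ‖f k‖) := by
    intro ε hε
    obtain ⟨W, hW, hWε⟩ := exists_forall_norm_sub_compress_le
      (f := fun k => G.val (u (basisOf E k))) (fun k => hG _ (val_mem _)) hε
    have h1 : ∀ i, ‖tensorSum (fun k => E.val (basisOf E k)) fun k => (F i).val (f k i)‖ ≤
        β * (‖tensorSum (fun k => compress W (G.val (u (basisOf E k))))
          fun k => (F i).val (f k i)‖ + ε * ∑ k, ‖f k‖) := by
      intro i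
      have h2 := norm_tensorSum_map_le hu' (fun k => u (basisOf E k)) fun k => (F i).val (f k i)
      simp only [LinearEquiv.coe_coe, LinearEquiv.symm_apply_apply] at h2
      refine h2.trans (mul_le_mul_of_nonneg_left ?_ hβ0)
      rw [← sub_le_iff_le_add']
      refine (norm_sub_norm_le _ _).trans ?_
      rw [← tensorSum_sub_left, Finset.mul_sum]
      refine (norm_tensorSum_le _ _).trans (Finset.sum_le_sum fun k _ => ?_)
      refine mul_le_mul (hWε k) ?_ (norm_nonneg _) hε.le
      rw [LinearIsometry.norm_map]
      exact lp.norm_apply_le_norm (by simp) (f k) i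
    have h3 := tendsto_norm_tensorSum_compress U W (fun k => G.val (u (basisOf E k)))
      fun k => valFam F (f k)
    refine (le_of_tendsto_of_tendsto' (tendsto_norm_tensorSum_famEquiv U E F f)
      ((h3.add_const (ε * ∑ k, ‖f k‖)).const_mul β) h1).trans ?_
    gcongr
    refine (norm_tensorSum_compress_left_le _ _ _).trans ?_
    exact norm_tensorSum_map_le hu (basisOf E) fun k => ultraOp U (valFam F (f k))
  have hlim : Tendsto (fun ε : ℝ => β * (α * ‖tensorSum (fun k => E.val (basisOf E k))
      fun k => ultraOp U (valFam F (f k))‖ + ε * ∑ k, ‖f k‖)) (𝓝[>] 0)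
      (𝓝 (β * (α * ‖tensorSum (fun k => E.val (basisOf E k))
      fun k => ultraOp U (valFam F (f k))‖ + 0 * ∑ k, ‖f k‖))) := by
    refine Tendsto.mono_left (Continuous.tendsto ?_ 0) nhdsWithin_le_nhds
    fun_prop
  refine (ge_of_tendsto hlim ?_).trans (le_of_eq (by ring))
  filter_upwards [self_mem_nhdsWithin] with ε hε
  exact key ε hε

theorem norm_canonicalEquiv_symm_le_of_dSK_le {C : ℝ} (hC : 1 ≤ C)
    (h : dSK E ≤ ENNReal.ofReal C) (y : minTensor E (opUltraproduct U F)) :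
    ‖(canonicalEquiv U E F).symm y‖ ≤ C * ‖y‖ := by
  -- The infimum defining `dSK` need not be attained, hence the passage through `C' > C`.
  have key : ∀ C' : ℝ, C < C' → ‖(canonicalEquiv U E F).symm y‖ ≤ C' * ‖y‖ := by
    intro C' hC'
    have h1 : dSK E < ENNReal.ofReal C' :=
      h.trans_lt ((ENNReal.ofReal_lt_ofReal_iff (by linarith)).2 hC')
    simp only [dSK, dcb, iInf_lt_iff] at h1
    obtain ⟨G, hG, hGc, u, hu⟩ := h1
    by_cases h0 : cbNorm u.toLinearMap = 0 ∨ cbNorm u.symm.toLinearMap = 0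
    · have hsub : Subsingleton E := by
        refine ⟨fun a b => ?_⟩
        rcases h0 with h0 | h0
        · have h2 : ∀ a, u a = 0 := fun a => LinearMap.congr_fun (eq_zero_of_cbNorm_eq_zero h0) a
          exact u.injective ((h2 a).trans (h2 b).symm)
        · have h2 : ∀ a, u.symm a = 0 := fun a =>
            LinearMap.congr_fun (eq_zero_of_cbNorm_eq_zero h0) a
          rw [← u.symm_apply_apply a, ← u.symm_apply_apply b, h2, h2]
      exact (norm_canonicalEquiv_symm_le_of_subsingleton U E F y).trans
        (mul_nonneg (by linarith) (norm_nonneg _))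
    · push Not at h0
      have hne : cbNorm u.toLinearMap ≠ ⊤ ∧ cbNorm u.symm.toLinearMap ≠ ⊤ := by
        constructor <;> intro htop <;> rw [htop] at hu
        · rw [ENNReal.top_mul h0.2] at hu
          exact not_top_lt hu
        · rw [ENNReal.mul_top h0.1] at hu
          exact not_top_lt hu
      refine (norm_canonicalEquiv_symm_le_of_compact U E F hGc u hne.1 hne.2 y).trans ?_
      gcongr
      rw [← ENNReal.toReal_mul]
      exact ENNReal.toReal_le_of_le_ofReal (by linarith) hu.le
  have hlim : Tendsto (fun t : ℝ => t * ‖y‖) (𝓝[>] C) (𝓝 (C * ‖y‖)) :=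
    ((continuous_id.mul continuous_const).tendsto _).mono_left nhdsWithin_le_nhds
  refine ge_of_tendsto hlim ?_
  filter_upwards [self_mem_nhdsWithin] with t ht
  exact key t ht

end Converse

/-! ### A countable family of compressions that determines norms -/

section Countable

variable {H : Type*} [NormedAddCommGroup H] [InnerProductSpace ℂ H] {ι : Type*} [Fintype ι]

/-- The Hilbert space `ℓ₂ᵐ`, in a given universe. -/
abbrev FinHilbert (m : ℕ) : Type v := EuclideanSpace ℂ (ULift.{v} (Fin m))

/-- The standard basis of `ℓ₂ᵐ`. -/
def finHilbertBasis (m : ℕ) : OrthonormalBasis (Fin m) ℂ (FinHilbert.{v} m) :=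
  (EuclideanSpace.basisFun (ULift.{v} (Fin m)) ℂ).reindex Equiv.ulift

theorem norm_tensorSum_compress_mono {K : Type*} [NormedAddCommGroup K] [InnerProductSpace ℂ K]
    {V W : Submodule ℂ H} [V.HasOrthogonalProjection] [W.HasOrthogonalProjection] (h : V ≤ W)
    (a : ι → H →L[ℂ] H) (b : ι → K →L[ℂ] K) :
    ‖tensorSum (fun k => compress V (a k)) b‖ ≤ ‖tensorSum (fun k => compress W (a k)) b‖ := by
  simpa only [compress_compress_of_le h] using
    norm_tensorSum_compress_left_le V (fun k => compress W (a k)) b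

/-- Both sides are the norm of the same matrix. Coefficients on an arbitrary Hilbert space thereby
reduce to coefficients on the spaces `ℓ₂ⁿ`. -/
theorem norm_tensorSum_compress_right_eq_matrixToOp {K : Type*} [NormedAddCommGroup K]
    [InnerProductSpace ℂ K] [CompleteSpace H] {W : Submodule ℂ K} [FiniteDimensional ℂ W] {n : ℕ}
    (h : OrthonormalBasis (Fin n) ℂ W) (a : ι → H →L[ℂ] H) (b : ι → K →L[ℂ] K) :
    ‖tensorSum a fun k => compress W (b k)‖ =
      ‖tensorSum a fun k => matrixToOp (finHilbertBasis.{v} n)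
        (Matrix.of fun i j => inner ℂ (h i : K) (b k (h j)))‖ := by
  rw [norm_tensorSum_compress_right_eq h, norm_tensorSum_eq_matrixOp (finHilbertBasis.{v} n)]
  simp only [inner_matrixToOp, Matrix.of_apply]

theorem exists_le_norm_tensorSum_compress {K : Type*} [NormedAddCommGroup K]
    [InnerProductSpace ℂ K] (a : ι → H →L[ℂ] H) (b : ι → K →L[ℂ] K) {ε : ℝ} (hε : 0 < ε) :
    ∃ s : Finset H, ‖tensorSum a b‖ - ε ≤
      ‖tensorSum (fun k => compress (Submodule.span ℂ (s : Set H)) (a k)) b‖ := by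
  by_contra! hs
  -- The empty set shows that the constant is nonnegative, as the bound through compressions
  -- requires.
  have h0 : 0 ≤ ‖tensorSum a b‖ - ε := (norm_nonneg _).trans (hs ∅).le
  have := norm_tensorSum_le_of_compress_left h0 fun s => (hs s).le
  linarith

theorem norm_tensorSum_le_mul_norm {K : Type*} [NormedAddCommGroup K]
    [InnerProductSpace ℂ K] (a : ι → H →L[ℂ] H) (b : ι → K →L[ℂ] K) :
    ‖tensorSum a b‖ ≤ (∑ k, ‖a k‖) * ‖b‖ := by
  rw [Finset.sum_mul]
  refine (norm_tensorSum_le a b).trans (Finset.sum_le_sum fun k _ => ?_)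
  gcongr
  exact norm_le_pi_norm b k

/-- An increasing sequence of finite dimensional subspaces that determines the norm of
`∑ a k ⊗ b k` for all operators `b k` on finite dimensional Hilbert spaces. -/
theorem exists_sequence_determining_norm (a : ι → H →L[ℂ] H) :
    ∃ s : ℕ → Finset H, Monotone s ∧
      ∀ (m : ℕ) (b : ι → FinHilbert.{v} m →L[ℂ] FinHilbert.{v} m) (c : ℝ),
        (∀ n, ‖tensorSum (fun k => compress (Submodule.span ℂ (s n : Set H)) (a k)) b‖ ≤ c) →
          ‖tensorSum a b‖ ≤ c := by
  classical
  have hsep : ∀ m : ℕ, TopologicalSpace.SeparableSpace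
      (ι → FinHilbert.{v} m →L[ℂ] FinHilbert.{v} m) := fun m =>
    haveI : ProperSpace (FinHilbert.{v} m →L[ℂ] FinHilbert.{v} m) := FiniteDimensional.proper ℂ _
    inferInstance
  -- For `p = (m, i, j)`, the set `s p` captures the norm for the `i`-th term of a dense sequence of
  -- tuples on `ℓ₂ᵐ`, up to `1 / (j + 1)`. Unions over initial segments of an enumeration of the
  -- triples give a monotone sequence.
  choose s hs using fun p : ℕ × ℕ × ℕ => exists_le_norm_tensorSum_compress a
    (TopologicalSpace.denseSeq (ι → FinHilbert.{v} p.1 →L[ℂ] FinHilbert.{v} p.1) p.2.1)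
    (show 0 < 1 / ((p.2.2 : ℝ) + 1) by positivity)
  refine ⟨fun n => (Finset.range n).biUnion fun q => s (Denumerable.ofNat _ q),
    fun n n' hn => Finset.biUnion_subset_biUnion_of_subset_left _ (by simpa using hn),
    fun m b c hc => ?_⟩
  refine le_of_forall_pos_le_add fun ε hε => ?_
  -- The `+ 1` keeps the divisor positive when all `a k` vanish. The three thirds of `ε` pay for
  -- replacing `b` by `b'`, for compressing, and for returning to `b`.
  have hM : 0 < ∑ k, ‖a k‖ + 1 := by positivity
  obtain ⟨i, hi⟩ := (TopologicalSpace.denseRange_denseSeq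
    (ι → FinHilbert.{v} m →L[ℂ] FinHilbert.{v} m)).exists_dist_lt b
    (show 0 < ε / 3 / (∑ k, ‖a k‖ + 1) by positivity)
  obtain ⟨j, hj⟩ := exists_nat_one_div_lt (show 0 < ε / 3 by positivity)
  set b' := TopologicalSpace.denseSeq (ι → FinHilbert.{v} m →L[ℂ] FinHilbert.{v} m) i with hb'
  have h1 := hs (m, i, j)
  simp only [← hb'] at h1
  obtain ⟨q, hq⟩ : ∃ q, Denumerable.ofNat (ℕ × ℕ × ℕ) q = (m, i, j) :=
    ⟨Encodable.encode (m, i, j), Denumerable.ofNat_encode _⟩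
  -- `Finset.range (q + 1)` is the first range that contains `q`.
  have h2 := hc (q + 1)
  have hle : Submodule.span ℂ (s (m, i, j) : Set H) ≤ Submodule.span ℂ
      (((Finset.range (q + 1)).biUnion fun q => s (Denumerable.ofNat _ q) : Finset H) : Set H) := by
    refine Submodule.span_mono fun x hx => ?_
    rw [Finset.mem_coe, Finset.mem_biUnion]
    exact ⟨q, by simp, by rw [hq]; exact hx⟩
  have h3 := norm_tensorSum_compress_mono hle a b'
  have h4 : ‖tensorSum a (fun k => b k - b' k)‖ ≤ ε / 3 := by
    refine (norm_tensorSum_le_mul_norm _ _).trans ?_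
    rw [dist_eq_norm, lt_div_iff₀ hM] at hi
    change _ * ‖b - b'‖ ≤ _
    nlinarith [norm_nonneg (b - b')]
  have h5 := (norm_tensorSum_compress_left_le (Submodule.span ℂ
      (((Finset.range (q + 1)).biUnion fun q => s (Denumerable.ofNat _ q) : Finset H) : Set H)) a
      (fun k => b k - b' k)).trans h4
  rw [tensorSum_sub_right] at h4 h5
  have h6 := norm_sub_norm_le (tensorSum a b) (tensorSum a b')
  have h7 := (norm_sub_rev _ _).trans_le h5
  have h8 := (norm_sub_norm_le _ _).trans h7
  linarith

end Countable

/-! ### A finite dimensional compression extracted from the bound on the inverse of `v_E` -/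

section Extraction

/-- The operator space spanned by finitely many operators on `ℓ₂ᵐ`. -/
def spanOperatorSpace {ι : Type*} [Finite ι] {m : ℕ}
    (b : ι → FinHilbert.{v} m →L[ℂ] FinHilbert.{v} m) : OperatorSpace.{v} where
  Hilb := FinHilbert.{v} m
  space := Submodule.span ℂ (Set.range b)
  isClosed := Submodule.closed_of_finiteDimensional _

/-- The operator `b k`, as an element of the operator space spanned by `b`. -/
def spanOperatorSpaceMk {ι : Type*} [Finite ι] {m : ℕ}
    (b : ι → FinHilbert.{v} m →L[ℂ] FinHilbert.{v} m) (k : ι) : spanOperatorSpace b :=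
  ofMem (E := spanOperatorSpace b) (T := b k)
    (show b k ∈ Submodule.span ℂ (Set.range b) from Submodule.subset_span (Set.mem_range_self k))

theorem norm_spanOperatorSpaceMk {ι : Type*} [Finite ι] {m : ℕ}
    (b : ι → FinHilbert.{v} m →L[ℂ] FinHilbert.{v} m) (k : ι) :
    ‖spanOperatorSpaceMk b k‖ = ‖b k‖ := rfl

theorem finrank_spanOperatorSpace_le {d m : ℕ}
    (b : Fin d → FinHilbert.{v} m →L[ℂ] FinHilbert.{v} m) :
    FiniteDimensional ℂ (spanOperatorSpace b) ∧ Module.finrank ℂ (spanOperatorSpace b) ≤ d :=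
  ⟨inferInstanceAs (FiniteDimensional ℂ (Submodule.span ℂ (Set.range b))),
    (finrank_range_le_card (R := ℂ) b).trans_eq (Fintype.card_fin _)⟩

/-- Slicing recovers each coefficient from the tensor, so tensors of norm `1` have coefficients
bounded independently of `m`; this makes them bounded families. -/
theorem norm_spanOperatorSpaceMk_le (E : OperatorSpace.{u}) [FiniteDimensional ℂ E] {m : ℕ}
    (b : Fin (Module.finrank ℂ E) → FinHilbert.{v} m →L[ℂ] FinHilbert.{v} m)
    (k : Fin (Module.finrank ℂ E)) :
    ‖spanOperatorSpaceMk b k‖ ≤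
      coordBound E k * ‖tensorSum (fun k => E.val (basisOf E k)) b‖ := by
  have h1 : coordSlice E (FinHilbert.{v} m) k (tensorSum (fun k => E.val (basisOf E k)) b) = b k :=
    coordSlice_sum b k
  have h2 := norm_coordSlice_le E k (tensorSum (fun k => E.val (basisOf E k)) b)
  rw [h1] at h2
  rwa [norm_spanOperatorSpaceMk]

theorem eventually_hyperfilter_le_down (n : ℕ) :
    ∀ᶠ i : ULift.{w} ℕ in (hyperfilter (ULift.{w} ℕ) : Ultrafilter _), n ≤ i.down := by
  have hfin : Set.Finite {i : ULift.{w} ℕ | ¬ n ≤ i.down} :=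
    ((Set.finite_lt_nat n).preimage ULift.down_injective.injOn).subset fun i hi => not_le.1 hi
  have h : ∀ᶠ i in (hyperfilter (ULift.{w} ℕ) : Filter (ULift.{w} ℕ)),
      i ∉ {i : ULift.{w} ℕ | ¬ n ≤ i.down} :=
    hyperfilter_le_cofinite hfin.eventually_cofinite_notMem
  exact h.mono fun i hi => not_not.1 hi

theorem hyperfilter_ne_pure {α : Type*} [Infinite α] (i : α) : hyperfilter α ≠ pure i := fun hi =>
  notMem_hyperfilter_of_finite (Set.finite_singleton i) (by
    rw [hi]
    exact Set.mem_singleton i)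

/-- Compressing the right leg to a finite dimensional space lets `hdet` reduce the claim to a fixed
`s n`. For the indices `i ≥ n`, which are almost all, compression to `s n` is dominated by
compression to `s i`. -/
theorem norm_tensorSum_ultraOp_le_of_determining {H : Type*} [NormedAddCommGroup H]
    [InnerProductSpace ℂ H] [CompleteSpace H] {ι : Type*} [Fintype ι] {a : ι → H →L[ℂ] H}
    {s : ℕ → Finset H} (hs : Monotone s)
    (hdet : ∀ (m : ℕ) (b : ι → FinHilbert.{v} m →L[ℂ] FinHilbert.{v} m) (c : ℝ),
      (∀ n, ‖tensorSum (fun k => compress (Submodule.span ℂ (s n : Set H)) (a k)) b‖ ≤ c) →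
        ‖tensorSum a b‖ ≤ c)
    {K : ULift.{w} ℕ → Type v} [∀ i, NormedAddCommGroup (K i)] [∀ i, InnerProductSpace ℂ (K i)]
    [∀ i, CompleteSpace (K i)] {b : ι → lp (fun i => K i →L[ℂ] K i) ∞} {c : ℝ} (hc : 0 ≤ c)
    (hb : ∀ i, ‖tensorSum (fun k => compress (Submodule.span ℂ (s i.down : Set H)) (a k))
      fun k => b k i‖ ≤ c) :
    ‖tensorSum a fun k => ultraOp (hyperfilter (ULift.{w} ℕ)) (b k)‖ ≤ c := by
  refine norm_tensorSum_le_of_compress_right hc fun t => ?_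
  have hW := stdOrthonormalBasis ℂ
    (Submodule.span ℂ (t : Set (Ultraproduct (hyperfilter (ULift.{w} ℕ)) K)))
  rw [norm_tensorSum_compress_right_eq_matrixToOp.{v} hW]
  refine hdet _ _ _ fun n => ?_
  rw [← norm_tensorSum_compress_right_eq_matrixToOp.{v} hW]
  refine (norm_tensorSum_compress_right_le _ _ _).trans (norm_tensorSum_ultraOp_le _ ?_)
  filter_upwards [eventually_hyperfilter_le_down n] with i hi
  exact (norm_tensorSum_compress_mono (Submodule.span_mono (Finset.coe_subset.2 (hs hi))) _ _).trans
    (hb i)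

/-- The bound on the inverse of `v_E` is tested on the class of `∑ e k ⊗ b n k`: it has norm `1` in
the ultraproduct of the tensor products, and its image under `v_E` has norm at most `c`. -/
theorem one_le_mul_of_norm_tensorSum_eq_one (E : OperatorSpace.{u}) [FiniteDimensional ℂ E]
    {C : ℝ} (hC : 0 ≤ C)
    (h : ∀ (I : Type w) [Countable I] (U : Ultrafilter I), (∀ i, U ≠ pure i) →
      ∀ F : I → OperatorSpace.{v},
        (∀ i, FiniteDimensional ℂ (F i) ∧ Module.finrank ℂ (F i) ≤ Module.finrank ℂ E) →
        ∀ y : minTensor E (opUltraproduct U F), ‖(canonicalEquiv U E F).symm y‖ ≤ C * ‖y‖)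
    {s : ℕ → Finset E.Hilb} (hs : Monotone s)
    (hdet : ∀ (m : ℕ)
      (b : Fin (Module.finrank ℂ E) → FinHilbert.{v} m →L[ℂ] FinHilbert.{v} m) (c : ℝ),
      (∀ n, ‖tensorSum (fun k => compress (Submodule.span ℂ (s n : Set E.Hilb))
        (E.val (basisOf E k))) b‖ ≤ c) → ‖tensorSum (fun k => E.val (basisOf E k)) b‖ ≤ c)
    {m : ℕ → ℕ}
    {b : ∀ n, Fin (Module.finrank ℂ E) → FinHilbert.{v} (m n) →L[ℂ] FinHilbert.{v} (m n)}
    (hb : ∀ n, ‖tensorSum (fun k => E.val (basisOf E k)) (b n)‖ = 1) {c : ℝ} (hc : 0 ≤ c)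
    (hbc : ∀ n, ‖tensorSum (fun k => compress (Submodule.span ℂ (s n : Set E.Hilb))
      (E.val (basisOf E k))) (b n)‖ ≤ c) :
    1 ≤ C * c := by
  let F : ULift.{w} ℕ → OperatorSpace.{v} := fun i => spanOperatorSpace (b i.down)
  let f : Fin (Module.finrank ℂ E) → lp (fun i => F i) ∞ := fun k =>
    ⟨fun i => spanOperatorSpaceMk (b i.down) k, memℓp_infty ⟨coordBound E k, by
      rintro _ ⟨i, rfl⟩
      have h1 := norm_spanOperatorSpaceMk_le E (b i.down) k
      rwa [hb, mul_one] at h1⟩⟩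
  have h1 := h (ULift.{w} ℕ) (hyperfilter _) hyperfilter_ne_pure F
    (fun i => finrank_spanOperatorSpace_le (b i.down))
    (canonicalEquiv _ E F (ultraMk _ (famEquiv (∑ k, basisOf E k ⊗ₜ[ℂ] f k))))
  rw [LinearEquiv.symm_apply_apply, norm_canonicalEquiv_famEquiv] at h1
  have h2 : ‖ultraMk (hyperfilter (ULift.{w} ℕ)) (famEquiv (∑ k, basisOf E k ⊗ₜ[ℂ] f k))‖ = 1 :=
    tendsto_nhds_unique (tendsto_norm_tensorSum_famEquiv _ E F f)
      (tendsto_const_nhds.congr fun i => (hb i.down).symm)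
  rw [h2] at h1
  exact h1.trans (mul_le_mul_of_nonneg_left
    (norm_tensorSum_ultraOp_le_of_determining hs hdet hc fun i => hbc i.down) hC)

/-- If every `s n` of a determining sequence failed, normalized counterexamples would have
compressed norm at most `1 / C'`, and the test of `v_E⁻¹` would give `1 ≤ C / C'`. -/
theorem exists_norm_tensorSum_le_mul_compress (E : OperatorSpace.{u}) [FiniteDimensional ℂ E]
    {C C' : ℝ} (hC : 1 ≤ C) (hCC' : C < C')
    (h : ∀ (I : Type w) [Countable I] (U : Ultrafilter I), (∀ i, U ≠ pure i) →
      ∀ F : I → OperatorSpace.{v},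
        (∀ i, FiniteDimensional ℂ (F i) ∧ Module.finrank ℂ (F i) ≤ Module.finrank ℂ E) →
        ∀ y : minTensor E (opUltraproduct U F), ‖(canonicalEquiv U E F).symm y‖ ≤ C * ‖y‖) :
    ∃ s : Finset E.Hilb, ∀ (m : ℕ)
      (b : Fin (Module.finrank ℂ E) → FinHilbert.{v} m →L[ℂ] FinHilbert.{v} m),
        ‖tensorSum (fun k => E.val (basisOf E k)) b‖ ≤
          C' * ‖tensorSum (fun k => compress (Submodule.span ℂ (s : Set E.Hilb))
            (E.val (basisOf E k))) b‖ := by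
  obtain ⟨s, hs, hdet⟩ := exists_sequence_determining_norm.{v} fun k => E.val (basisOf E k)
  by_contra! hcon
  choose m b₀ hb₀ using fun n => hcon (s n)
  have hC' : 0 < C' := by linarith
  have hpos : ∀ n, 0 < ‖tensorSum (fun k => E.val (basisOf E k)) (b₀ n)‖ := fun n =>
    (mul_nonneg hC'.le (norm_nonneg _)).trans_lt (hb₀ n)
  obtain ⟨b, hb1, hb2⟩ : ∃ b : ∀ n, Fin (Module.finrank ℂ E) →
      FinHilbert.{v} (m n) →L[ℂ] FinHilbert.{v} (m n),
      (∀ n, ‖tensorSum (fun k => E.val (basisOf E k)) (b n)‖ = 1) ∧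
      ∀ n, ‖tensorSum (fun k => compress (Submodule.span ℂ (s n : Set E.Hilb))
            (E.val (basisOf E k))) (b n)‖ ≤ C'⁻¹ := by
    refine ⟨fun n k => ((‖tensorSum (fun k => E.val (basisOf E k)) (b₀ n)‖⁻¹ : ℝ) : ℂ) • b₀ n k,
      fun n => ?_, fun n => ?_⟩
    · rw [tensorSum_smul_right, norm_smul, Complex.norm_real,
        Real.norm_of_nonneg (inv_nonneg.2 (hpos n).le), inv_mul_cancel₀ (hpos n).ne']
    · rw [tensorSum_smul_right, norm_smul, Complex.norm_real,
        Real.norm_of_nonneg (inv_nonneg.2 (hpos n).le), inv_mul_le_iff₀ (hpos n), ← div_eq_mul_inv,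
        le_div_iff₀ hC', mul_comm]
      exact (hb₀ n).le
  have h1 := one_le_mul_of_norm_tensorSum_eq_one E (by linarith) h hs hdet hb1
    (inv_nonneg.2 hC'.le) hb2
  rw [← div_eq_mul_inv, one_le_div hC'] at h1
  linarith

end Extraction

/-! ### Moving a finite dimensional subspace into `ℓ₂` -/

section Embedding

variable {H : Type*} [NormedAddCommGroup H] [InnerProductSpace ℂ H] [CompleteSpace H]

/-- `J` sends the first vectors of the standard basis of `ℓ₂` to an orthonormal basis of `V` and
kills the others; it has finite rank. -/
theorem exists_coisometry_hilbertSeq (V : Submodule ℂ H) [FiniteDimensional ℂ V] :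
    ∃ J : HilbertSeq →L[ℂ] H, ‖J‖ ≤ 1 ∧ IsCompactOperator J ∧
      J ∘L ContinuousLinearMap.adjoint J = V.starProjection := by
  classical
  have h := stdOrthonormalBasis ℂ V
  let δ : HilbertBasis ℕ ℂ HilbertSeq := HilbertBasis.ofRepr (LinearIsometryEquiv.refl ℂ _)
  let J : HilbertSeq →L[ℂ] H := ∑ i, InnerProductSpace.rankOne ℂ (h i : H) (δ i)
  have hJ : J ∘L ContinuousLinearMap.adjoint J = V.starProjection := by
    rw [h.starProjection_eq_sum_rankOne]
    simp only [J, map_sum, InnerProductSpace.adjoint_rankOne, ContinuousLinearMap.finsetSum_comp,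
      ContinuousLinearMap.comp_finsetSum, InnerProductSpace.rankOne_comp_rankOne]
    refine Finset.sum_congr rfl fun i _ => ?_
    rw [Finset.sum_eq_single i]
    · rw [inner_self_eq_norm_sq_to_K, δ.orthonormal.1]
      simp
    · intro j _ hj
      rw [δ.orthonormal.2 fun hij => hj (Fin.ext hij), zero_smul]
    · simp
  refine ⟨J, ?_, ?_, hJ⟩
  -- By the C*-identity, `‖J‖² = ‖J J*‖ = ‖P_V‖ ≤ 1`.
  · have h1 := ContinuousLinearMap.norm_adjoint_comp_self (ContinuousLinearMap.adjoint J)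
    rw [ContinuousLinearMap.adjoint_adjoint, hJ, LinearIsometryEquiv.norm_map] at h1
    have h2 := V.starProjection_norm_le
    nlinarith [norm_nonneg J]
  · have e : J = V.subtypeL ∘L (V.orthogonalProjectionOnto ∘L J) := by
      change J = V.starProjection ∘L J
      simp only [J, ContinuousLinearMap.comp_finsetSum, InnerProductSpace.comp_rankOne]
      exact Finset.sum_congr rfl fun i _ => by
        rw [Submodule.starProjection_eq_self_iff.2 (h i).2]
    have : ProperSpace V := FiniteDimensional.proper ℂ V
    rw [e]
    exact IsCompactOperator.comp_clm (f := V.subtypeL)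
      (isCompactOperator_of_locallyCompactSpace_rng V.subtypeL) (V.orthogonalProjectionOnto ∘L J)

end Embedding

/-! ### The bound on `dSK` -/

section Distance

/-- A matrix over `E` is expanded along the basis, its scalar coefficient matrices becoming the
right legs. Taking `φ` to be the identity or a compression gives the two norms to be compared. -/
theorem matrixNorm_eq_tensorSum (E : OperatorSpace.{u}) [FiniteDimensional ℂ E] {n : ℕ}
    (A : Matrix (Fin n) (Fin n) E) (φ : (E.Hilb →L[ℂ] E.Hilb) →ₗ[ℂ] (E.Hilb →L[ℂ] E.Hilb)) :
    ‖matrixOp (A.map fun a => φ (E.val a))‖ =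
      ‖tensorSum (fun k => φ (E.val (basisOf E k))) fun k => matrixToOp (finHilbertBasis.{v} n)
        (A.map ((basisOf E).coord k))‖ := by
  rw [norm_tensorSum_eq_matrixOp (finHilbertBasis.{v} n)]
  congr 2
  ext1 i j
  simp only [inner_matrixToOp, Matrix.of_apply, Matrix.map_apply, Module.Basis.coord_apply]
  conv_lhs => rw [← (basisOf E).sum_repr (A i j)]
  simp only [map_sum, map_smul]

/-- If the compression to a finite dimensional subspace is bounded below by `C⁻¹` at all matrix
levels, then `E` is `C`-completely isomorphic to a space of compact operators. -/
theorem dSK_le_of_compress {E : OperatorSpace.{u}} [FiniteDimensional ℂ E] {C : ℝ} (hC : 0 ≤ C)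
    (V : Submodule ℂ E.Hilb) [FiniteDimensional ℂ V]
    (h : ∀ (n : ℕ) (A : Matrix (Fin n) (Fin n) E),
      matrixNorm E A ≤ C * ‖matrixOp (A.map fun a => compress V (E.val a))‖) :
    dSK E ≤ ENNReal.ofReal C := by
  obtain ⟨J, hJ1, hJc, hJ⟩ := exists_coisometry_hilbertSeq V
  have hJ1' : ‖ContinuousLinearMap.adjoint J‖ ≤ 1 := by rwa [LinearIsometryEquiv.norm_map]
  let L : E →ₗ[ℂ] (HilbertSeq →L[ℂ] HilbertSeq) :=
    { toFun := fun a => ContinuousLinearMap.adjoint J ∘L E.val a ∘L J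
      map_add' := fun a b => by ext1 x; simp
      map_smul' := fun c a => by ext1 x; simp }
  have hL : ∀ (n : ℕ) (A : Matrix (Fin n) (Fin n) E), matrixNorm E A ≤ C * ‖matrixOp (A.map L)‖ := by
    intro n A
    refine (h n A).trans (mul_le_mul_of_nonneg_left ?_ hC)
    -- Since `J J* = P_V`, the compression of `a` is `J (J* a J) J*`, so it is controlled by `L a`
    -- at all matrix levels.
    refine le_trans (le_of_eq ?_) (norm_matrixOp_comp_le hJ1 hJ1' (A.map L))
    congr 2
    ext1 i j
    change compress V (E.val (A i j)) =
      J ∘L (ContinuousLinearMap.adjoint J ∘L E.val (A i j) ∘L J) ∘L ContinuousLinearMap.adjoint J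
    rw [compress_apply, ← hJ]
    simp only [ContinuousLinearMap.comp_assoc]
  have hinj : Function.Injective L := by
    -- Injectivity is the lower bound `hL` for `1 × 1` matrices.
    refine (injective_iff_map_eq_zero _).2 fun a ha => eq_zero_of_matrixNorm_le_zero ?_
    refine (hL 1 _).trans (le_of_eq ?_)
    have h0 : (Matrix.of fun _ _ : Fin 1 => a).map L = 0 := by
      ext1 i j
      exact ha
    have h1 : matrixOp (0 : Matrix (Fin 1) (Fin 1) (HilbertSeq →L[ℂ] HilbertSeq)) = 0 := by
      ext1 x
      refine PiLp.ext fun i => ?_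
      rw [matrixOp_apply]
      simp
    rw [h0, h1, norm_zero, mul_zero]
  have hclosed : IsClosed (LinearMap.range L : Set (HilbertSeq →L[ℂ] HilbertSeq)) :=
    Submodule.closed_of_finiteDimensional _
  have hcompact : ∀ T ∈ LinearMap.range L, IsCompactOperator T := by
    rintro _ ⟨a, rfl⟩
    exact hJc.clm_comp (ContinuousLinearMap.adjoint J ∘L E.val a)
  let G : OperatorSpace.{0} := ⟨HilbertSeq, LinearMap.range L, hclosed⟩
  let u : E ≃ₗ[ℂ] G := LinearEquiv.ofInjective L hinj
  have hu : ∀ {n : ℕ} (A : Matrix (Fin n) (Fin n) E),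
      matrixNorm G (A.map u) = ‖matrixOp (A.map L)‖ := fun A => rfl
  have h1 : cbNorm u.toLinearMap ≤ ENNReal.ofReal 1 := by
    refine cbNorm_le zero_le_one fun n A => ?_
    rw [one_mul]
    exact (hu A).trans_le (norm_matrixOp_comp_le hJ1' hJ1 (A.map E.val))
  have h2 : cbNorm u.symm.toLinearMap ≤ ENNReal.ofReal C := by
    refine cbNorm_le hC fun n B => ?_
    have h3 := hL n (B.map u.symm)
    rw [← hu] at h3
    have e : (B.map u.symm).map u = B := by
      ext1 i j
      exact u.apply_symm_apply (B i j)
    rw [e] at h3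
    exact h3
  have h4 : dcb E G ≤ ENNReal.ofReal C := by
    have h5 : dcb E G ≤ cbNorm u.toLinearMap * cbNorm u.symm.toLinearMap :=
      iInf_le (fun u : E ≃ₗ[ℂ] G => cbNorm u.toLinearMap * cbNorm u.symm.toLinearMap) u
    refine (h5.trans (mul_le_mul' h1 h2)).trans (le_of_eq ?_)
    rw [ENNReal.ofReal_one, one_mul]
  exact iInf₂_le_of_le (LinearMap.range L) hclosed (iInf_le_of_le hcompact h4)

theorem dSK_le_of_norm_canonicalEquiv_symm_le (E : OperatorSpace.{u}) [FiniteDimensional ℂ E]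
    {C : ℝ} (hC : 1 ≤ C)
    (h : ∀ (I : Type w) [Countable I] (U : Ultrafilter I), (∀ i, U ≠ pure i) →
      ∀ F : I → OperatorSpace.{v},
        (∀ i, FiniteDimensional ℂ (F i) ∧ Module.finrank ℂ (F i) ≤ Module.finrank ℂ E) →
        ∀ y : minTensor E (opUltraproduct U F), ‖(canonicalEquiv U E F).symm y‖ ≤ C * ‖y‖) :
    dSK E ≤ ENNReal.ofReal C := by
  have key : ∀ C' : ℝ, C < C' → dSK E ≤ ENNReal.ofReal C' := by
    intro C' hC'
    obtain ⟨s, hs⟩ := exists_norm_tensorSum_le_mul_compress E hC hC' h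
    refine dSK_le_of_compress (by linarith) (Submodule.span ℂ (s : Set E.Hilb)) fun n A => ?_
    have h1 := matrixNorm_eq_tensorSum.{u, v} E A LinearMap.id
    have h2 := matrixNorm_eq_tensorSum.{u, v} E A (compress (Submodule.span ℂ (s : Set E.Hilb)))
    rw [h2]
    exact h1.trans_le (hs n _)
  have hlim : Tendsto (fun t : ℝ => ENNReal.ofReal t) (𝓝[>] C) (𝓝 (ENNReal.ofReal C)) :=
    (ENNReal.continuous_ofReal.tendsto _).mono_left nhdsWithin_le_nhds
  refine ge_of_tendsto hlim ?_
  filter_upwards [self_mem_nhdsWithin] with t ht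
  exact key t ht

end Distance

end OpSpace

end

theorem proposition6 (E : OpSpace.OperatorSpace.{u}) [FiniteDimensional ℂ E] (C : ℝ) (hC : 1 ≤ C) :
    (∀ (I : Type w) (U : Ultrafilter I) (F : I → OpSpace.OperatorSpace.{v})
        (x : OpSpace.Ultraproduct U fun i => OpSpace.minTensor E (F i)),
        ‖OpSpace.canonicalEquiv U E F x‖ ≤ ‖x‖) ∧
    List.TFAE [
      OpSpace.dSK E ≤ ENNReal.ofReal C,
      ∀ (I : Type w) (U : Ultrafilter I), (∀ i, U ≠ pure i) →
        ∀ (F : I → OpSpace.OperatorSpace.{v})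
          (y : OpSpace.minTensor E (OpSpace.opUltraproduct U F)),
          ‖(OpSpace.canonicalEquiv U E F).symm y‖ ≤ C * ‖y‖,
      ∀ (I : Type w) [Countable I] (U : Ultrafilter I), (∀ i, U ≠ pure i) →
        ∀ F : I → OpSpace.OperatorSpace.{v},
          (∀ i, FiniteDimensional ℂ (F i) ∧ Module.finrank ℂ (F i) ≤ Module.finrank ℂ E) →
          ∀ y : OpSpace.minTensor E (OpSpace.opUltraproduct U F),
            ‖(OpSpace.canonicalEquiv U E F).symm y‖ ≤ C * ‖y‖] := by
  refine ⟨fun I U F x => OpSpace.norm_canonicalEquiv_le U E F x, ?_⟩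
  tfae_have 1 → 2 := fun h I U _ F y =>
    OpSpace.norm_canonicalEquiv_symm_le_of_dSK_le U E F hC h y
  tfae_have 2 → 3 := fun h I _ U hU F _ y => h I U hU F y
  tfae_have 3 → 1 := fun h => OpSpace.dSK_le_of_norm_canonicalEquiv_symm_le E hC h
  tfae_finish
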